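/- Let $A\in\mathbb R^{n\times n}$, $B\in\mathbb R^{n}$ with $(A,B)$ stabilizable (discrete time), and let $M(A)=\prod_{i=1}^n\max\{1,|\lambda_i(A)|\}$ be the Mahler measure of $A$. Consider $N$ agents $x_i(k+1)=Ax_i(k)+Bu_i(k)$, $i=1,\dots,N$, on a directed graph $\mathcal G$ in which the leader, agent $1$, receives no information and has a directed path to every other agent, and in which the subgraph of the followers $2,\dots,N$ is undirected. Let $a_{ij}\in\{0,1\}$ ($a_{ij}=1$ iff $i\neq j$ and agent $i$ receives information from agent $j$) be the adjacency matrix and $\mathcal L$ the Laplacian ($\mathcal L_{ii}=\sum_j a_{ij}$, $\mathcal L_{ij}=-a_{ij}$ for $i\ne j$), with nonzero eigenvalues $\lambda_2\le\dots\le\lambda_N$. The leader's input is $u_1=0$ and the followers use the protocol $$u_i(k)=\alpha\sum_{j=1}^N a_{ij}\,[1+\Delta_{ij}(k)]\,K\,[x_i(k)-x_j(k)],\qquad i=2,\dots,N,$$ with $\alpha>0$ and $K\in\mathbb R^{1\times n}$, where the channel uncertainties $\Delta_{ij}(k)$ (for $a_{ij}=1$, $k\ge 0$) are real random variables, mutually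 independent over all channels and all times, with $\mathbf E\,\Delta_{ij}(k)=0$ and $\mathbf E\,\Delta_{ij}(k)^2=\sigma_{ij}^2$. Let $\tilde\sigma_{\max}^2$ be the maximum of the numbers $\sigma_{j1}^2$ over the followers $j$ with $a_{j1}=1$ and $\sigma_{ij}^2+\sigma_{ji}^2$ over the pairs of followers $i,j$ with $a_{ij}=1$. If $$(\alpha\lambda_i-1)^2+\alpha^2\tilde\sigma_{\max}^2\lambda_i<\frac1{M(A)^2},\qquad i=2,N,$$ then there is a gain $K$ (depending only on $A$, $B$, $\mathcal G$, $\alpha$ and the $\sigma_{ij}$) such that, for all such uncertainties and all square integrable initial states independent of them (in particular all deterministic ones), mean-square leader-follower consensus is achieved: $\mathbf E\|x_i(k)-x_j(k)\|^2<\infty$ for all $k$ and $\lim_{k\to\infty}\mathbf E\|x_i(k)-x_j(k)\|^2=0$ for all $i,j=1,\dots,N$. Moreover $K$ can be taken of the form $K=-(B^TPB)^{-1}B^TPA$ (read as $K=0$ if $B=0$), where $P>0$ solves the modified algebraic Riccati equation $$P=A^TPA-(1-\delta^2)A^TPB(B^TPB)^{-1}B^TPA+Q$$ (whose middle term is omitted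 if $B=0$) for some $Q>0$ and some $\delta\in\mathbb R$ with $\max_{i=2,N}\{(\alpha\lambda_i-1)^2+\alpha^2\tilde\sigma_{\max}^2\lambda_i\}\le\delta^2<1/M(A)^2$. -/

import Mathlib

open Matrix MeasureTheory ProbabilityTheory Filter Topology

noncomputable section

namespace LeaderFollower

/-! ### Linear systems -/

/-- The single-input pair `(A, B)` is (discrete-time) stabilizable: some state feedback row `F`
places all complex eigenvalues of `A + B F` in the open unit disc. -/
def Stabilizable {n : ℕ} (A : Matrix (Fin n) (Fin n) ℝ) (B : Fin n → ℝ) : Prop :=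
  ∃ F : Fin n → ℝ,
    ∀ z ∈ spectrum ℂ ((A + vecMulVec B F).map (algebraMap ℝ ℂ)), ‖z‖ < 1

/-- The Mahler measure `M(A) = ∏ᵢ max {1, |λᵢ(A)|}`, the product being over the complex
eigenvalues of `A` counted with algebraic multiplicity. -/
def mahler {n : ℕ} (A : Matrix (Fin n) (Fin n) ℝ) : ℝ :=
  ((A.map (algebraMap ℝ ℂ)).charpoly.roots.map (fun z => max 1 ‖z‖)).prod

/-- The modified algebraic Riccati equation
`P = AᵀPA - (1 - δ²) AᵀPB (BᵀPB)⁻¹ BᵀPA + Q`. -/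
def IsMARESolution {n : ℕ} (A : Matrix (Fin n) (Fin n) ℝ) (B : Fin n → ℝ) (δ : ℝ)
    (Q P : Matrix (Fin n) (Fin n) ℝ) : Prop :=
  P = Aᵀ * P * A
    - ((1 - δ ^ 2) * (B ⬝ᵥ (P *ᵥ B))⁻¹) • vecMulVec ((Aᵀ * P) *ᵥ B) (B ᵥ* (P * A)) + Q

/-- The row vector `K = -(BᵀPB)⁻¹ BᵀPA`. -/
def riccatiGain {n : ℕ} (A : Matrix (Fin n) (Fin n) ℝ) (B : Fin n → ℝ)
    (P : Matrix (Fin n) (Fin n) ℝ) : Fin n → ℝ :=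
  -((B ⬝ᵥ (P *ᵥ B))⁻¹ • (B ᵥ* (P * A)))

/-! ### Communication graph -/

/-- Agent `i` receives information from agent `j`: `(j, i)` is an edge (self-loops are ignored). -/
def IsChannel {N : ℕ} (G : Digraph (Fin N)) (i j : Fin N) : Prop :=
  i ≠ j ∧ G.Adj j i

open Classical in
/-- The non-weighted adjacency matrix: `a i j = 1` if `(j, i)` is an edge, `a i i = 0`. -/
def adjacency {N : ℕ} (G : Digraph (Fin N)) : Matrix (Fin N) (Fin N) ℝ :=
  Matrix.of fun i j => if IsChannel G i j then 1 else 0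

/-- The Laplacian of a directed graph: `L i i = ∑ j, a i j` and `L i j = - a i j` for `i ≠ j`. -/
def laplacian {N : ℕ} (G : Digraph (Fin N)) : Matrix (Fin N) (Fin N) ℝ :=
  Matrix.of fun i j => if i = j then ∑ m, adjacency G i m else -adjacency G i j

/-- The nonzero (real) eigenvalues of the Laplacian. -/
def nonzeroEigenvalues {N : ℕ} (G : Digraph (Fin N)) : Set ℝ :=
  {c | c ≠ 0 ∧ Module.End.HasEigenvalue (Matrix.toLin' (laplacian G)) c}

/-- Leader-follower graph with leader `l`: the leader receives no information, it has a directed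
path to every agent, and the subgraph of the followers is undirected. -/
structure IsLeaderFollower {N : ℕ} (G : Digraph (Fin N)) (l : Fin N) : Prop where
  leader_no_parent : ∀ j, ¬ G.Adj j l
  rooted : ∀ i, Relation.ReflTransGen G.Adj l i
  followers_undirected : ∀ i j, i ≠ l → j ≠ l → G.Adj i j → G.Adj j i

/-! ### Stochastic channels -/

/-- The values over which the maximal channel variance is taken: `σ_{jl}²` for the channels from
the leader to a follower `j`, and `σ_{ij}² + σ_{ji}²` for the bidirectional channels between
followers `i` and `j`. -/
def channelVariances {N : ℕ} (G : Digraph (Fin N)) (l : Fin N) (σ : Fin N → Fin N → ℝ) : Set ℝ :=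
  {v | ∃ j, j ≠ l ∧ IsChannel G j l ∧ v = σ j l ^ 2} ∪
  {v | ∃ i j, i ≠ l ∧ j ≠ l ∧ IsChannel G i j ∧ v = σ i j ^ 2 + σ j i ^ 2}

/-- The family of all channel uncertainties, indexed by channels `(i, j)` and times `k`. -/
def noiseFamily {N : ℕ} (G : Digraph (Fin N)) {Ω : Type*} (Δ : ℕ → Fin N → Fin N → Ω → ℝ)
    (p : {e : Fin N × Fin N // IsChannel G e.1 e.2} × ℕ) (ω : Ω) : ℝ :=
  Δ p.2 p.1.1.1 p.1.1.2 ω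

/-- On the channels of the graph, `Δ k i j` are square integrable, mutually independent over all
channels and times, with mean zero and variance `σ_{ij}²`. -/
structure IsChannelNoise {N : ℕ} (G : Digraph (Fin N)) (σ : Fin N → Fin N → ℝ) {Ω : Type*}
    [MeasurableSpace Ω] (μ : Measure Ω) (Δ : ℕ → Fin N → Fin N → Ω → ℝ) : Prop where
  memLp : ∀ k i j, IsChannel G i j → MemLp (Δ k i j) 2 μ
  indep : iIndepFun (noiseFamily G Δ) μ
  mean : ∀ k i j, IsChannel G i j → ∫ ω, Δ k i j ω ∂μ = 0
  variance : ∀ k i j, IsChannel G i j → ∫ ω, Δ k i j ω ^ 2 ∂μ = σ i j ^ 2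

/-! ### Closed loop -/

/-- The control inputs: zero for the leader `l`, and
`u_i = α ∑_j a_{ij} (1 + Δ_{ij}) K (x_i - x_j)` for the followers. -/
def controlInput {N n : ℕ} (G : Digraph (Fin N)) (l : Fin N) (α : ℝ) (K : Fin n → ℝ)
    (D : Fin N → Fin N → ℝ) (x : Fin N → Fin n → ℝ) (i : Fin N) : ℝ :=
  if i = l then 0
  else α * ∑ j, adjacency G i j * (1 + D i j) * (K ⬝ᵥ (x i - x j))

/-- The states of the agents, `x_i(k+1) = A x_i(k) + B u_i(k)`, for the initial states `x0` and a
realization `D` of the uncertainties. -/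
def trajectory {N n : ℕ} (A : Matrix (Fin n) (Fin n) ℝ) (B : Fin n → ℝ) (G : Digraph (Fin N))
    (l : Fin N) (α : ℝ) (K : Fin n → ℝ) (D : ℕ → Fin N → Fin N → ℝ) (x0 : Fin N → Fin n → ℝ) :
    ℕ → Fin N → Fin n → ℝ
  | 0 => x0
  | k + 1 => fun i =>
      A *ᵥ trajectory A B G l α K D x0 k i
        + controlInput G l α K (D k) (trajectory A B G l α K D x0 k) i • B

/-- Mean square consensus of random states: `E ‖x_i(k) - x_j(k)‖²` is finite for all `k` and
tends to `0` (Euclidean norm), for all agents `i`, `j`. -/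
def MeanSquareConsensus {N n : ℕ} {Ω : Type*} [MeasurableSpace Ω] (μ : Measure Ω)
    (x : ℕ → Fin N → Ω → Fin n → ℝ) : Prop :=
  ∀ i j,
    (∀ k, Integrable (fun ω => ‖WithLp.toLp 2 (x k i ω - x k j ω)‖ ^ 2) μ) ∧
    Tendsto (fun k => ∫ ω, ‖WithLp.toLp 2 (x k i ω - x k j ω)‖ ^ 2 ∂μ) atTop (𝓝 0)

end LeaderFollower

end

/-! The Lyapunov function is the total energy `∑ i, eᵢᵀ P eᵢ` of the tracking errors `eᵢ = x_i -
x_l`. Put `ξᵢ = K eᵢ` and `b = Bᵀ P B`. For the Riccati gain `b ξᵢ = -Bᵀ P A eᵢ`, so after one step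
the mean energy is the mean of `∑ (A eᵢ)ᵀ P (A eᵢ)` plus `b` times the mean of `α²|Lξ|² - 2α ξᵀLξ +
α² ∑ aᵢⱼ σᵢⱼ² (ξᵢ - ξⱼ)²`. The noise enters only through its variance, since the present state is
independent of the present uncertainties.

A pair of adjacent agents contributes `(ξᵢ - ξⱼ)²` to `ξᵀLξ`, so the last sum is at most `s ξᵀLξ`.
As `ξ` vanishes at the leader, it expands in eigenvectors of a symmetric matrix, and only nonzero
Laplacian eigenvalues `λ` occur. The bracket is then controlled by `(αλ - 1)² + α²sλ - 1`, which is
convex in `λ`; its values at the extreme eigenvalues bound it by `δ² - 1`. The Riccati equation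
turns this into a decrease of at least `∑ eᵢᵀ Q eᵢ`, hence geometric decay
(`integral_trackingEnergy_step_le`).

It remains to solve the Riccati equation for every `0 < δ² < 1 / M(A)²`. The core is
`exists_riccati_energy_inequality`: for each `γ > M(A)²` there are a feedback and a `P > 0` with `1
+ B*PB < γ` whose energy strictly dominates the control cost plus the energy of the next state.
Unstable eigenvalues are treated one at a time; each `λ` costs a factor of `1 + B*PB` slightly above
`|λ|²`, whence the square of the Mahler measure. The construction is complex. Passing to `P⁻¹` makes
the conditions linear, so the real part can be taken; inverting again gives a real Riccati
inequality, and `Q` is defined as the residual of the equation. -/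

noncomputable section

namespace LeaderFollower

/-! ### Eigenvalue shift by rank-one feedback. -/

section

open scoped ComplexOrder

open Polynomial in
/-- Rank-one feedback along a left eigenvector moves only the corresponding eigenvalue. -/
theorem charpoly_add_vecMulVec_of_left_eigenvector {n : ℕ} {A : Matrix (Fin n) (Fin n) ℂ}
    {B w : Fin n → ℂ} {lam c : ℂ} (hw : w ᵥ* A = lam • w) (hw0 : w ≠ 0) :
    (X - C lam) * (A + vecMulVec B (c • w)).charpoly
      = (X - C (lam + c * (w ⬝ᵥ B))) * A.charpoly := by
  obtain ⟨m, rfl⟩ : ∃ m, n = m + 1 := by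
    cases n with
    | zero => exact absurd (Subsingleton.elim w 0) hw0
    | succ m => exact ⟨m, rfl⟩
  apply Polynomial.eq_of_infinite_eval_eq
  -- Off `t = lam` the factor `t - lam` can be cancelled; infinitely many such `t` suffice for a
  -- polynomial identity.
  refine Set.Infinite.mono (s := {lam}ᶜ) ?_ (Set.finite_singleton lam).infinite_compl
  intro t ht
  have ht0 : t - lam ≠ 0 := sub_ne_zero.2 ht
  simp only [Set.mem_ofPred_eq, eval_mul, eval_sub, eval_X, eval_C]
  have hdet : (scalar (Fin (m + 1)) (t - lam) - vecMulVec B (c • w)).det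
      = (t - lam) ^ m * (t - (lam + c * (w ⬝ᵥ B))) := by
    rw [← eval_charpoly, charpoly_vecMulVec]
    simp [dotProduct_smul, dotProduct_comm B w]
    ring
  -- Since `w` is a left eigenvector, multiplying the rank-one term by `A` only scales it by `lam`;
  -- this factors the shifted pencil, and determinants reduce to the rank-one case.
  have hprod : (t - lam) • (scalar (Fin (m + 1)) t - (A + vecMulVec B (c • w)))
      = (scalar (Fin (m + 1)) (t - lam) - vecMulVec B (c • w))
        * (scalar (Fin (m + 1)) t - A) := by
    have h1 : vecMulVec B (c • w) * A = lam • vecMulVec B (c • w) := by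
      rw [vecMulVec_mul, smul_vecMul, hw, smul_comm c lam w, vecMulVec_smul]
    rw [sub_mul, mul_sub (vecMulVec B (c • w)), h1]
    simp only [scalar_apply, ← smul_one_eq_diagonal, smul_mul_assoc, one_mul, mul_smul_comm,
      mul_one]
    module
  have h := congrArg det hprod
  rw [det_smul, det_mul, hdet, Fintype.card_fin, ← eval_charpoly, ← eval_charpoly] at h
  apply mul_left_cancel₀ (pow_ne_zero m ht0)
  linear_combination h

/-! ### Hermitian forms and the Lyapunov inequality. -/

/-- The real part of the sesquilinear form of a matrix on the diagonal. -/
def hermForm {n : ℕ} (P : Matrix (Fin n) (Fin n) ℂ) (x : Fin n → ℂ) : ℝ :=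
  (star x ⬝ᵥ (P *ᵥ x)).re

theorem posDef_iff_hermForm {n : ℕ} {P : Matrix (Fin n) (Fin n) ℂ} :
    P.PosDef ↔ P.IsHermitian ∧ ∀ x, x ≠ 0 → 0 < hermForm P x := by
  rw [posDef_iff_dotProduct_mulVec]
  refine and_congr_right fun hP => forall_congr' fun x => imp_congr_right fun _ => ?_
  have him : (star x ⬝ᵥ (P *ᵥ x)).im = 0 := hP.im_star_dotProduct_mulVec_self x
  rw [Complex.pos_iff, hermForm, him]
  simp

@[simp]
theorem hermForm_zero {n : ℕ} (P : Matrix (Fin n) (Fin n) ℂ) : hermForm P 0 = 0 := by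
  simp [hermForm]

theorem hermForm_nonneg {n : ℕ} {P : Matrix (Fin n) (Fin n) ℂ} (hP : P.PosDef)
    (x : Fin n → ℂ) : 0 ≤ hermForm P x := by
  rcases eq_or_ne x 0 with rfl | hx
  · simp
  · exact ((posDef_iff_hermForm.1 hP).2 x hx).le

theorem hermForm_add {n : ℕ} (P Q : Matrix (Fin n) (Fin n) ℂ) (x : Fin n → ℂ) :
    hermForm (P + Q) x = hermForm P x + hermForm Q x := by
  simp [hermForm, add_mulVec]

theorem hermForm_smul {n : ℕ} (r : ℝ) (P : Matrix (Fin n) (Fin n) ℂ) (x : Fin n → ℂ) :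
    hermForm ((r : ℂ) • P) x = r * hermForm P x := by
  simp [hermForm, smul_mulVec]

theorem hermForm_sum {n : ℕ} {ι : Type*} (s : Finset ι) (P : ι → Matrix (Fin n) (Fin n) ℂ)
    (x : Fin n → ℂ) : hermForm (∑ k ∈ s, P k) x = ∑ k ∈ s, hermForm (P k) x := by
  simp [hermForm, sum_mulVec, dotProduct_sum]

theorem hermForm_vecMulVec_star {n : ℕ} (w x : Fin n → ℂ) :
    hermForm (vecMulVec (star w) w) x = ‖w ⬝ᵥ x‖ ^ 2 := by
  have h : star x ⬝ᵥ star w = star (w ⬝ᵥ x) := by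
    rw [star_dotProduct_star]
  rw [hermForm, vecMulVec_mulVec, op_smul_eq_smul, dotProduct_smul, h, smul_eq_mul,
    Complex.star_def, Complex.mul_conj, Complex.ofReal_re, Complex.normSq_eq_norm_sq]

theorem hermForm_conjTranspose_mul_self {n : ℕ} (M : Matrix (Fin n) (Fin n) ℂ)
    (x : Fin n → ℂ) : hermForm (Mᴴ * M) x = ‖WithLp.toLp 2 (M *ᵥ x)‖ ^ 2 := by
  rw [EuclideanSpace.norm_sq_eq, hermForm, ← mulVec_mulVec, dotProduct_mulVec, vecMul_conjTranspose,
    star_star, dotProduct, Complex.re_sum]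
  refine Finset.sum_congr rfl fun i _ => ?_
  rw [Pi.star_apply, Complex.star_def, mul_comm, Complex.mul_conj, Complex.ofReal_re,
    Complex.normSq_eq_norm_sq]

-- By Gelfand's formula `‖A ^ m‖ ^ (1 / m)` tends to the spectral radius, which is below one.
open scoped Matrix.Norms.L2Operator in
theorem exists_pow_norm_lt_one {n : ℕ} {A : Matrix (Fin n) (Fin n) ℂ}
    (hA : ∀ z ∈ spectrum ℂ A, ‖z‖ < 1) : ∃ m, 0 < m ∧ ‖A ^ m‖ < 1 := by
  rcases Nat.eq_zero_or_pos n with rfl | hn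
  · exact ⟨1, one_pos, by rw [Subsingleton.elim (A ^ 1) 0, norm_zero]; exact one_pos⟩
  have : Nonempty (Fin n) := ⟨⟨0, hn⟩⟩
  have hr : spectralRadius ℂ A < (1 : NNReal) :=
    spectrum.spectralRadius_lt_of_forall_lt A fun z hz => by
      exact_mod_cast hA z hz
  have h := (spectrum.pow_nnnorm_pow_one_div_tendsto_nhds_spectralRadius A).eventually
    (gt_mem_nhds hr)
  obtain ⟨m, hm, hm0⟩ := (h.and (eventually_gt_atTop 0)).exists
  refine ⟨m, hm0, ?_⟩
  by_contra hge
  have h1 : (1 : ENNReal) ≤ ‖A ^ m‖₊ := by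
    rw [not_lt] at hge
    exact_mod_cast hge
  have h2 : (1 : ENNReal) ≤ (‖A ^ m‖₊ : ENNReal) ^ (1 / (m : ℝ)) :=
    ENNReal.one_le_rpow h1 (by positivity)
  exact absurd hm (not_lt.2 (by simpa using h2))

open scoped Matrix.Norms.L2Operator in
/-- Discrete-time Lyapunov inequality for a Schur stable matrix. -/
theorem exists_lyapunov {n : ℕ} {A : Matrix (Fin n) (Fin n) ℂ}
    (hA : ∀ z ∈ spectrum ℂ A, ‖z‖ < 1) :
    ∃ P : Matrix (Fin n) (Fin n) ℂ, P.PosDef ∧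
      ∀ x, x ≠ 0 → hermForm P (A *ᵥ x) < hermForm P x := by
  obtain ⟨m, hm0, hm⟩ := exists_pow_norm_lt_one hA
  have hform : ∀ x, hermForm (∑ k ∈ Finset.range m, (A ^ k)ᴴ * A ^ k) x
      = ∑ k ∈ Finset.range m, ‖WithLp.toLp 2 (A ^ k *ᵥ x)‖ ^ 2 := fun x => by
    simp only [hermForm_sum, hermForm_conjTranspose_mul_self]
  -- A truncated Lyapunov series is enough: replacing `x` by `A x` shifts the sum, trading the term
  -- `‖x‖²` for the smaller `‖A ^ m x‖²`.
  refine ⟨∑ k ∈ Finset.range m, (A ^ k)ᴴ * A ^ k, posDef_iff_hermForm.2 ⟨?_, ?_⟩, ?_⟩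
  · rw [IsHermitian, conjTranspose_sum]
    simp [conjTranspose_mul]
  · intro x hx
    rw [hform]
    refine Finset.sum_pos' (fun _ _ => by positivity) ⟨0, Finset.mem_range.2 hm0, ?_⟩
    have : 0 < ‖WithLp.toLp 2 x‖ := norm_pos_iff.2 (by simpa using hx)
    rw [pow_zero, one_mulVec]
    positivity
  · intro x hx
    rw [hform, hform]
    have hshift : ∀ k, A ^ k *ᵥ (A *ᵥ x) = A ^ (k + 1) *ᵥ x := fun k => by
      rw [mulVec_mulVec, pow_succ]
    simp only [hshift]
    have htel := Finset.sum_range_succ' (fun k => ‖WithLp.toLp 2 (A ^ k *ᵥ x)‖ ^ 2) m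
    rw [Finset.sum_range_succ] at htel
    have hx0 : 0 < ‖WithLp.toLp 2 x‖ := norm_pos_iff.2 (by simpa using hx)
    have hlt : ‖WithLp.toLp 2 (A ^ m *ᵥ x)‖ < ‖WithLp.toLp 2 x‖ := by
      have h1 := l2_opNorm_mulVec (A ^ m) (WithLp.toLp 2 x)
      refine lt_of_le_of_lt h1 ?_
      nlinarith
    have hsq : ‖WithLp.toLp 2 (A ^ m *ᵥ x)‖ ^ 2 < ‖WithLp.toLp 2 x‖ ^ 2 :=
      pow_lt_pow_left₀ hlt (norm_nonneg _) two_ne_zero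
    simp only [pow_zero, one_mulVec] at htel
    linarith

/-! ### Control energy and the Mahler measure. -/

/-- The Mahler measure of the characteristic polynomial of a complex matrix. -/
def complexMahler {n : ℕ} (A : Matrix (Fin n) (Fin n) ℂ) : ℝ :=
  (A.charpoly.roots.map (fun z => max 1 ‖z‖)).prod

theorem one_le_prod_map_max (R : Multiset ℂ) : 1 ≤ (R.map (fun z => max 1 ‖z‖)).prod := by
  induction R using Multiset.induction_on with
  | empty => simp
  | cons z R ih =>
    rw [Multiset.map_cons, Multiset.prod_cons]
    exact one_le_mul_of_one_le_of_one_le (le_max_left _ _) ih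

theorem isRoot_charpoly_iff_left_eigenvector {n : ℕ} {A : Matrix (Fin n) (Fin n) ℂ} {z : ℂ} :
    A.charpoly.IsRoot z ↔ ∃ w, w ≠ 0 ∧ w ᵥ* A = z • w := by
  rw [Polynomial.IsRoot, eval_charpoly, ← exists_vecMul_eq_zero_iff]
  refine exists_congr fun w => and_congr_right fun _ => ?_
  rw [vecMul_sub, sub_eq_zero, eq_comm]
  simp [scalar_apply, ← smul_one_eq_diagonal, vecMul_smul]

theorem vecMulVec_mulVec_eq_smul {n : ℕ} {R : Type*} [CommRing R] (B F x : Fin n → R) :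
    vecMulVec B F *ᵥ x = (F ⬝ᵥ x) • B := by
  rw [vecMulVec_mulVec, op_smul_eq_smul]

/-- The energy identity for the feedback `f = -p λ conj β / ρ * t`, `ρ = 1 + p ‖β‖²`, that moves
the eigenvalue `λ` to `λ / ρ`. -/
theorem mode_energy (p rho : ℝ) (lam beta t v : ℂ) (hrho : rho = 1 + p * ‖beta‖ ^ 2)
    (hrho0 : rho ≠ 0) :
    ‖-(p * lam * star beta / rho) * t + v‖ ^ 2
      + p * ‖lam * t + (-(p * lam * star beta / rho) * t + v) * beta‖ ^ 2
      = ‖lam‖ ^ 2 * p / rho * ‖t‖ ^ 2 + rho * ‖v‖ ^ 2 := by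
  have hb : (‖beta‖ ^ 2 : ℝ) = beta.re ^ 2 + beta.im ^ 2 := by
    rw [← Complex.normSq_eq_norm_sq, Complex.normSq_apply]; ring
  have hrc : (rho : ℂ) = 1 + p * (beta * star beta) := by
    rw [Complex.star_def, Complex.mul_conj, Complex.normSq_eq_norm_sq, hrho]
    push_cast; ring
  have hrc0 : (rho : ℂ) ≠ 0 := by exact_mod_cast hrho0
  apply Complex.ofReal_injective
  push_cast
  simp only [← Complex.conj_mul', map_add, map_mul, map_neg, map_div₀, Complex.star_def,
    Complex.conj_conj, Complex.conj_ofReal]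
  rw [Complex.star_def] at hrc
  field_simp
  rw [hrc]
  ring

/-- Induction on the number `k` of eigenvalues outside the open unit disc. With `w` a left
eigenvector for such a `λ`, feedback along `w` moves `λ` to `λ / ρ` inside the disc, with `ρ` just
above `|λ|²`. If `P₂` serves the remaining system with bound `γ / ρ`, then `P = p w*w + ρ P₂` serves
the original one, because `1 + B*PB = ρ (1 + B*P₂B)`. -/
theorem exists_riccati_energy_inequality {n : ℕ} (k : ℕ) :
    ∀ (A : Matrix (Fin n) (Fin n) ℂ) (B : Fin n → ℂ) (gam : ℝ),
      A.charpoly.roots.countP (fun z => 1 ≤ ‖z‖) = k →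
      (∃ F, ∀ z ∈ spectrum ℂ (A + vecMulVec B F), ‖z‖ < 1) →
      complexMahler A ^ 2 < gam →
      ∃ (P : Matrix (Fin n) (Fin n) ℂ) (F : Fin n → ℂ), P.PosDef ∧ 1 + hermForm P B < gam ∧
        ∀ x, x ≠ 0 →
          ‖F ⬝ᵥ x‖ ^ 2 + hermForm P (A *ᵥ x + (F ⬝ᵥ x) • B) < hermForm P x := by
  induction k with
  | zero =>
    intro A B gam hcount _ hgam
    have hA : ∀ z ∈ spectrum ℂ A, ‖z‖ < 1 := by
      intro z hz
      rw [mem_spectrum_iff_isRoot_charpoly] at hz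
      rw [Multiset.countP_eq_zero] at hcount
      exact not_le.1 (hcount z ((Polynomial.mem_roots A.charpoly_monic.ne_zero).2 hz))
    obtain ⟨P, hP, hlt⟩ := exists_lyapunov hA
    have hgam1 : 1 < gam := by
      have : 1 ≤ complexMahler A := one_le_prod_map_max _
      nlinarith
    have hb := hermForm_nonneg hP B
    -- With no unstable eigenvalue zero feedback works, and the Lyapunov matrix is scaled down until
    -- `1 + r B*PB < gam`.
    set r : ℝ := (gam - 1) / (hermForm P B + 1) with hr
    have hr0 : 0 < r := div_pos (by linarith) (by linarith)
    refine ⟨(r : ℂ) • P, 0, hP.smul (by exact_mod_cast hr0), ?_, ?_⟩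
    · have : r * (hermForm P B + 1) = gam - 1 := div_mul_cancel₀ _ (by linarith)
      rw [hermForm_smul]
      linarith
    · intro x hx
      simp only [zero_dotProduct, norm_zero, zero_smul, add_zero, hermForm_smul]
      have := hlt x hx
      nlinarith
  | succ k ih =>
    intro A B gam hcount hstab hgam
    obtain ⟨lam, hlam, hlam1⟩ := Multiset.countP_pos.1 (by omega :
      0 < A.charpoly.roots.countP (fun z => 1 ≤ ‖z‖))
    obtain ⟨w, hw0, hw⟩ := isRoot_charpoly_iff_left_eigenvector.1
      ((Polynomial.mem_roots A.charpoly_monic.ne_zero).1 hlam)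
    obtain ⟨R, hR⟩ := Multiset.exists_cons_of_mem hlam
    set m : ℝ := (R.map (fun z => max 1 ‖z‖)).prod with hm
    have hm1 : 1 ≤ m := one_le_prod_map_max R
    have hMA : complexMahler A = ‖lam‖ * m := by
      rw [complexMahler, hR, Multiset.map_cons, Multiset.prod_cons, max_eq_right hlam1]
    obtain ⟨F, hF⟩ := hstab
    -- Hautus test: if `w ⬝ᵥ B = 0`, then `lam` survives every feedback, against stabilizability.
    have hbeta : w ⬝ᵥ B ≠ 0 := by
      intro h0
      refine absurd (hF lam ?_) (not_lt.2 hlam1)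
      rw [mem_spectrum_iff_isRoot_charpoly, isRoot_charpoly_iff_left_eigenvector]
      exact ⟨w, hw0, by rw [vecMul_add, hw, vecMul_vecMulVec, h0, zero_smul, add_zero]⟩
    set beta := w ⬝ᵥ B with hbetadef
    -- The lower bound on `rho` puts `lam / rho` inside the disc; the upper bound leaves `m² < gam /
    -- rho`, as the induction hypothesis requires.
    obtain ⟨rho, hrho1, hrho2⟩ : ∃ rho, ‖lam‖ ^ 2 < rho ∧ rho < gam / m ^ 2 := by
      apply exists_between
      rw [lt_div_iff₀ (by positivity)]
      rw [hMA] at hgam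
      nlinarith
    have hrho_one : 1 < rho := by nlinarith
    have hrho0 : 0 < rho := by linarith
    have hnb : 0 < ‖beta‖ ^ 2 := by positivity
    -- Chosen so that `1 + p ‖beta‖² = rho`.
    set p : ℝ := (rho - 1) / ‖beta‖ ^ 2 with hp
    have hp0 : 0 < p := div_pos (by linarith) hnb
    have hprho : rho = 1 + p * ‖beta‖ ^ 2 := by
      rw [hp, div_mul_cancel₀ _ hnb.ne']; ring
    set c : ℂ := -(p * lam * star beta / rho) with hc
    have hmu : lam + c * beta = lam / rho := by
      have hrc : (rho : ℂ) = 1 + p * (beta * star beta) := by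
        rw [Complex.star_def, Complex.mul_conj, Complex.normSq_eq_norm_sq]
        conv_lhs => rw [hprho]
        push_cast; ring
      have hrc0 : (rho : ℂ) ≠ 0 := by exact_mod_cast hrho0.ne'
      rw [hc]
      field_simp
      rw [hrc]
      ring
    have hmu1 : ‖(lam / rho : ℂ)‖ < 1 := by
      rw [norm_div, Complex.norm_real, Real.norm_of_nonneg hrho0.le, div_lt_one hrho0]
      nlinarith
    set A1 := A + vecMulVec B (c • w) with hA1
    have hroots : A1.charpoly.roots = (lam / rho : ℂ) ::ₘ R := by
      have h := congrArg Polynomial.roots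
        (charpoly_add_vecMulVec_of_left_eigenvector (B := B) (c := c) hw hw0)
      rw [← hbetadef, hmu,
        Polynomial.roots_mul (mul_ne_zero (Polynomial.X_sub_C_ne_zero _)
          (charpoly_monic _).ne_zero),
        Polynomial.roots_mul (mul_ne_zero (Polynomial.X_sub_C_ne_zero _)
          (charpoly_monic _).ne_zero), Polynomial.roots_X_sub_C, Polynomial.roots_X_sub_C, hR,
        Multiset.singleton_add, Multiset.singleton_add, Multiset.cons_swap] at h
      exact (Multiset.cons_inj_right _).1 h
    obtain ⟨P, F2, hP, hPB, hlt⟩ := ih A1 B (gam / rho)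
      (by
        rw [hR, Multiset.countP_cons_of_pos (p := fun z : ℂ => 1 ≤ ‖z‖) _ hlam1] at hcount
        rw [hroots, Multiset.countP_cons_of_neg (p := fun z : ℂ => 1 ≤ ‖z‖) _ (not_le.2 hmu1)]
        omega)
      ⟨F - c • w, by
        have : A1 + vecMulVec B (F - c • w) = A + vecMulVec B F := by
          rw [vecMulVec_sub, hA1]; abel
        rwa [this]⟩
      (by
        rw [complexMahler, hroots, Multiset.map_cons, Multiset.prod_cons, max_eq_left hmu1.le,
          one_mul, ← hm, lt_div_iff₀ hrho0]
        rw [lt_div_iff₀ (by positivity)] at hrho2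
        linarith)
    have hPw : ((p : ℂ) • vecMulVec (star w) w).PosSemidef :=
      (posSemidef_vecMulVec_star_self w).smul (by exact_mod_cast hp0.le)
    have hform : ∀ x, hermForm ((p : ℂ) • vecMulVec (star w) w + (rho : ℂ) • P) x
        = p * ‖w ⬝ᵥ x‖ ^ 2 + rho * hermForm P x := fun x => by
      rw [hermForm_add, hermForm_smul, hermForm_smul, hermForm_vecMulVec_star]
    refine ⟨(p : ℂ) • vecMulVec (star w) w + (rho : ℂ) • P, c • w + F2,
      PosDef.posSemidef_add hPw (hP.smul (by exact_mod_cast hrho0)), ?_, ?_⟩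
    · rw [hform, ← hbetadef]
      rw [lt_div_iff₀ hrho0] at hPB
      nlinarith
    · intro x hx
      have hx2 := hlt x hx
      have hFx : (c • w + F2) ⬝ᵥ x = c * (w ⬝ᵥ x) + F2 ⬝ᵥ x := by
        rw [add_dotProduct, smul_dotProduct, smul_eq_mul]
      have hstep : A *ᵥ x + ((c • w + F2) ⬝ᵥ x) • B = A1 *ᵥ x + (F2 ⬝ᵥ x) • B := by
        rw [hA1, add_mulVec, vecMulVec_mulVec_eq_smul, smul_dotProduct, add_dotProduct,
          smul_dotProduct, add_smul, add_assoc]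
      have hwx : w ⬝ᵥ (A *ᵥ x + ((c • w + F2) ⬝ᵥ x) • B)
          = lam * (w ⬝ᵥ x) + (c * (w ⬝ᵥ x) + F2 ⬝ᵥ x) * beta := by
        rw [dotProduct_add, dotProduct_mulVec, hw, smul_dotProduct, dotProduct_smul, hFx]
        simp [hbetadef]
      have hen := mode_energy p rho lam beta (w ⬝ᵥ x) (F2 ⬝ᵥ x) hprho hrho0.ne'
      rw [← hc] at hen
      -- By `mode_energy` the mode contributes at most its own energy `p ‖w ⬝ᵥ x‖²`; the leftover
      -- `rho ‖F2 ⬝ᵥ x‖²` is absorbed by `rho` times the inductive inequality.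
      have hle : ‖lam‖ ^ 2 * p / rho ≤ p := by
        rw [div_le_iff₀ hrho0]
        nlinarith
      have hle' := mul_le_mul_of_nonneg_right hle (sq_nonneg ‖w ⬝ᵥ x‖)
      have hlt' := mul_lt_mul_of_pos_left hx2 hrho0
      rw [hform, hform, hwx, hstep, hFx]
      linarith

/-! ### Duality and descent to real matrices. -/

theorem hermForm_sub {n : ℕ} {P : Matrix (Fin n) (Fin n) ℂ} (hP : P.IsHermitian)
    (u z : Fin n → ℂ) :
    hermForm P (u - z) = hermForm P u - 2 * (star (P *ᵥ u) ⬝ᵥ z).re + hermForm P z := by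
  have h1 : star u ⬝ᵥ (P *ᵥ z) = star (P *ᵥ u) ⬝ᵥ z := by
    rw [star_mulVec, hP.eq, dotProduct_mulVec]
  have h2 : (star z ⬝ᵥ (P *ᵥ u)).re = (star (P *ᵥ u) ⬝ᵥ z).re := by
    rw [← Complex.conj_re, ← Complex.star_def, star_dotProduct, star_star]
  simp only [hermForm, star_sub, mulVec_sub, dotProduct_sub, sub_dotProduct, Complex.sub_re, h1, h2]
  ring

/-- Young's inequality for dual forms: expand `0 ≤ hermForm P (P⁻¹ y - z)`. -/
theorem two_mul_re_le_hermForm {n : ℕ} {P : Matrix (Fin n) (Fin n) ℂ} (hP : P.PosDef)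
    (y z : Fin n → ℂ) :
    2 * (star y ⬝ᵥ z).re ≤ hermForm P⁻¹ y + hermForm P z := by
  have hdet : IsUnit P.det := (isUnit_iff_isUnit_det _).1 hP.isUnit
  have hPP : P *ᵥ (P⁻¹ *ᵥ y) = y := by rw [mulVec_mulVec, mul_nonsing_inv _ hdet, one_mulVec]
  have h := hermForm_nonneg hP (P⁻¹ *ᵥ y - z)
  have h1 : hermForm P (P⁻¹ *ᵥ y) = hermForm P⁻¹ y := by
    rw [hermForm, hPP, star_mulVec, hP.inv.isHermitian.eq, ← dotProduct_mulVec, hermForm]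
  rw [hermForm_sub hP.isHermitian, hPP, h1] at h
  linarith

/-- Young's inequality at the multiple `z = (conj b / c) B`, where `b = y* B`. This is the bound on
`B*PB` rewritten as a condition linear in `P⁻¹`. -/
theorem norm_sq_dotProduct_le {n : ℕ} {P : Matrix (Fin n) (Fin n) ℂ} (hP : P.PosDef)
    {B : Fin n → ℂ} {c : ℝ} (hc : 0 < c) (hB : hermForm P B ≤ c) (y : Fin n → ℂ) :
    ‖star y ⬝ᵥ B‖ ^ 2 ≤ c * hermForm P⁻¹ y := by
  set b := star y ⬝ᵥ B with hb
  have h := two_mul_re_le_hermForm hP y ((star b / c) • B)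
  have h1 : (star y ⬝ᵥ ((star b / c) • B)).re = ‖b‖ ^ 2 / c := by
    rw [dotProduct_smul, ← hb, smul_eq_mul, div_mul_eq_mul_div, Complex.star_def,
      Complex.conj_mul']
    norm_cast
  have h2 : hermForm P ((star b / c) • B) = ‖b‖ ^ 2 / c ^ 2 * hermForm P B := by
    have h3 : star (star b / c : ℂ) * (star b / c) = ((‖b‖ ^ 2 / c ^ 2 : ℝ) : ℂ) := by
      rw [Complex.star_def, Complex.conj_mul', norm_div, Complex.norm_real,
        Real.norm_of_nonneg hc.le, RCLike.norm_conj]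
      push_cast; ring
    rw [hermForm, mulVec_smul, dotProduct_smul, star_smul, smul_dotProduct, smul_smul,
      mul_comm, h3, smul_eq_mul, Complex.re_ofReal_mul, hermForm]
  have h3 : ‖b‖ ^ 2 / c ^ 2 * hermForm P B ≤ ‖b‖ ^ 2 / c := by
    refine (mul_le_mul_of_nonneg_left hB (by positivity)).trans_eq ?_
    field_simp
  rw [h1, h2] at h
  have h4 : ‖b‖ ^ 2 / c ≤ hermForm P⁻¹ y := by linarith
  rw [div_le_iff₀ hc] at h4
  linarith

/-- Dualizing eliminates the feedback: test the hypothesis at `x = P⁻¹ Aᴴ y`, apply Young's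
inequality to `y` and the closed-loop image of `x`, and absorb the cross term in `F x` into the
control cost and `|y* B|²`. -/
theorem hermForm_inv_conjTranspose_mulVec_lt {n : ℕ} {A P : Matrix (Fin n) (Fin n) ℂ}
    {B F : Fin n → ℂ} (hP : P.PosDef)
    (h : ∀ x, x ≠ 0 → ‖F ⬝ᵥ x‖ ^ 2 + hermForm P (A *ᵥ x + (F ⬝ᵥ x) • B) < hermForm P x)
    {y : Fin n → ℂ} (hy : y ≠ 0) :
    hermForm P⁻¹ (Aᴴ *ᵥ y) < hermForm P⁻¹ y + ‖star y ⬝ᵥ B‖ ^ 2 := by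
  have hdet : IsUnit P.det := (isUnit_iff_isUnit_det _).1 hP.isUnit
  have hpos := (posDef_iff_hermForm.1 hP.inv).2 y hy
  set x := P⁻¹ *ᵥ (Aᴴ *ᵥ y) with hx
  have hPx : P *ᵥ x = Aᴴ *ᵥ y := by rw [hx, mulVec_mulVec, mul_nonsing_inv _ hdet, one_mulVec]
  have hN : hermForm P⁻¹ (Aᴴ *ᵥ y) = hermForm P x := by
    rw [hermForm, ← hx, ← hPx, star_mulVec, hP.isHermitian.eq, ← dotProduct_mulVec, hermForm]
  rcases eq_or_ne x 0 with h0 | h0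
  · rw [hN, h0, hermForm_zero]
    positivity
  have hyAx : (star y ⬝ᵥ (A *ᵥ x)).re = hermForm P x := by
    rw [← hN, hermForm, ← hx, star_mulVec, conjTranspose_conjTranspose, dotProduct_mulVec]
  have hyoung := two_mul_re_le_hermForm hP y (A *ᵥ x + (F ⬝ᵥ x) • B)
  rw [dotProduct_add, Complex.add_re, hyAx, dotProduct_smul, smul_eq_mul] at hyoung
  have hcs : -(2 * ((F ⬝ᵥ x) * (star y ⬝ᵥ B)).re) ≤ ‖F ⬝ᵥ x‖ ^ 2 + ‖star y ⬝ᵥ B‖ ^ 2 := by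
    have h1 := (neg_le_abs _).trans (Complex.abs_re_le_norm ((F ⬝ᵥ x) * (star y ⬝ᵥ B)))
    rw [norm_mul] at h1
    nlinarith [sq_nonneg (‖F ⬝ᵥ x‖ - ‖star y ⬝ᵥ B‖)]
  have := h x h0
  rw [hN]
  linarith

/-- Real data: a real positive definite solution of the dual linear matrix inequalities. -/
theorem exists_real_dual_solution {n : ℕ} {A : Matrix (Fin n) (Fin n) ℝ} {B : Fin n → ℝ}
    (hAB : Stabilizable A B) {gam : ℝ} (hgam : mahler A ^ 2 < gam) :
    ∃ X : Matrix (Fin n) (Fin n) ℝ, X.PosDef ∧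
      (∀ y, (y ⬝ᵥ B) ^ 2 ≤ (gam - 1) * (y ⬝ᵥ (X *ᵥ y))) ∧
      ∀ y, y ≠ 0 → (Aᵀ *ᵥ y) ⬝ᵥ (X *ᵥ (Aᵀ *ᵥ y)) < y ⬝ᵥ (X *ᵥ y) + (y ⬝ᵥ B) ^ 2 := by
  set Ac := A.map (algebraMap ℝ ℂ) with hAc
  set toC : (Fin n → ℝ) → (Fin n → ℂ) := fun y i => (y i : ℂ) with htoC
  have hgam1 : 0 < gam - 1 := by
    have : 1 ≤ mahler A := one_le_prod_map_max _
    nlinarith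
  obtain ⟨P, F, hP, hPB, hlt⟩ := exists_riccati_energy_inequality _ Ac (toC B) gam rfl
    (by
      obtain ⟨F, hF⟩ := hAB
      refine ⟨toC F, ?_⟩
      have : Ac + vecMulVec (toC B) (toC F) = (A + vecMulVec B F).map (algebraMap ℝ ℂ) := by
        ext i j
        simp [hAc, htoC, vecMulVec_apply]
      rwa [this]) hgam
  have hstar : ∀ y, star (toC y) = toC y := fun y => by
    ext i
    simp [htoC]
  have hform : ∀ y, hermForm P⁻¹ (toC y) = y ⬝ᵥ (P⁻¹.map Complex.re *ᵥ y) := fun y => by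
    rw [hermForm, hstar]
    simp [dotProduct, mulVec, htoC, Complex.re_sum]
  have hdot : ∀ y z, toC y ⬝ᵥ toC z = ((y ⬝ᵥ z : ℝ) : ℂ) := fun y z => by
    simp [dotProduct, htoC]
  have hAt : ∀ y, Acᴴ *ᵥ toC y = toC (Aᵀ *ᵥ y) := fun y => by
    ext i
    simp [dotProduct, mulVec, htoC, hAc, conjTranspose_apply]
  have hne : ∀ y, y ≠ 0 → toC y ≠ 0 := fun y hy h0 => hy <| by
    ext i
    simpa [htoC] using congrFun h0 i
  -- On real vectors the form of `P⁻¹` is that of its entrywise real part, and the dual conditions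
  -- are linear in it.
  refine ⟨P⁻¹.map Complex.re, PosDef.of_dotProduct_mulVec_pos ?_ ?_, ?_, ?_⟩
  · ext i j
    have := congrArg Complex.re (congrFun (congrFun hP.inv.isHermitian.eq i) j)
    simpa [conjTranspose_apply] using this
  · intro y hy
    rw [star_trivial, ← hform]
    exact (posDef_iff_hermForm.1 hP.inv).2 _ (hne y hy)
  · intro y
    have := norm_sq_dotProduct_le hP hgam1 (by linarith) (toC y)
    rw [hstar, hdot, Complex.norm_real, Real.norm_eq_abs, sq_abs, hform] at this
    exact this
  · intro y hy
    have := hermForm_inv_conjTranspose_mulVec_lt hP hlt (hne y hy)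
    rw [hstar, hdot, Complex.norm_real, Real.norm_eq_abs, sq_abs, hform, hAt, hform] at this
    exact this

/-! ### The Riccati inequality and the modified Riccati equation. -/

theorem dotProduct_mulVec_comm_of_isSymm {n : ℕ} {P : Matrix (Fin n) (Fin n) ℝ}
    (hP : P.IsHermitian) (x y : Fin n → ℝ) : x ⬝ᵥ (P *ᵥ y) = y ⬝ᵥ (P *ᵥ x) := by
  rw [dotProduct_mulVec, dotProduct_comm, ← mulVec_transpose, ← conjTranspose_eq_transpose_of_trivial,
    hP.eq]

/-- The matrix is the inverse of the dual solution `X`; the dual inequality is tested at the vector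
`(X + BBᵀ)⁻¹ A x`. -/
theorem exists_riccati_inequality {n : ℕ} {A : Matrix (Fin n) (Fin n) ℝ} {B : Fin n → ℝ}
    (hAB : Stabilizable A B) {gam : ℝ} (hgam : mahler A ^ 2 < gam) :
    ∃ P : Matrix (Fin n) (Fin n) ℝ, P.PosDef ∧ 1 + B ⬝ᵥ (P *ᵥ B) ≤ gam ∧
      ∀ x, x ≠ 0 → (A *ᵥ x) ⬝ᵥ (P *ᵥ (A *ᵥ x))
        - (B ⬝ᵥ (P *ᵥ (A *ᵥ x))) ^ 2 / (1 + B ⬝ᵥ (P *ᵥ B)) < x ⬝ᵥ (P *ᵥ x) := by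
  obtain ⟨X, hX, hXB, hXA⟩ := exists_real_dual_solution hAB hgam
  have hdet : IsUnit X.det := (isUnit_iff_isUnit_det _).1 hX.isUnit
  have hXP : ∀ y, X *ᵥ (X⁻¹ *ᵥ y) = y := fun y => by
    rw [mulVec_mulVec, mul_nonsing_inv _ hdet, one_mulVec]
  have hgam1 : 0 < gam - 1 := by
    have : 1 ≤ mahler A := one_le_prod_map_max _
    nlinarith
  have hsX := dotProduct_mulVec_comm_of_isSymm hX.isHermitian
  have hsP := dotProduct_mulVec_comm_of_isSymm hX.inv.isHermitian
  have hb0 : 0 ≤ B ⬝ᵥ (X⁻¹ *ᵥ B) := by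
    simpa using hX.inv.posSemidef.dotProduct_mulVec_nonneg B
  set b := B ⬝ᵥ (X⁻¹ *ᵥ B) with hb
  refine ⟨X⁻¹, hX.inv, ?_, ?_⟩
  · have h := hXB (X⁻¹ *ᵥ B)
    rw [hXP, dotProduct_comm, ← hb] at h
    by_contra hlt
    nlinarith
  · intro x hx
    rw [← hb]
    set z := A *ᵥ x with hz
    set r := B ⬝ᵥ (X⁻¹ *ᵥ z) with hr
    -- Sherman–Morrison: this `y` solves `(X + BBᵀ) y = z`, so `y ⬝ᵥ z` is exactly the left side of
    -- the Riccati inequality.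
    set y := X⁻¹ *ᵥ z - (r / (1 + b)) • (X⁻¹ *ᵥ B) with hy
    have hxpos : 0 < x ⬝ᵥ (X⁻¹ *ᵥ x) := by
      simpa using hX.inv.dotProduct_mulVec_pos hx
    have hyz : y ⬝ᵥ z = z ⬝ᵥ (X⁻¹ *ᵥ z) - r ^ 2 / (1 + b) := by
      rw [hy, sub_dotProduct, smul_dotProduct, dotProduct_comm _ z, dotProduct_comm _ z,
        hsP z B, ← hr, smul_eq_mul]
      ring
    rw [← hyz]
    rcases eq_or_ne y 0 with h0 | h0
    · rw [h0, zero_dotProduct]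
      exact hxpos
    have hyB : y ⬝ᵥ B = r / (1 + b) := by
      rw [dotProduct_comm, hy, dotProduct_sub, dotProduct_smul, ← hr, ← hb, smul_eq_mul]
      field_simp
      ring
    have hyXy : y ⬝ᵥ (X *ᵥ y) + (y ⬝ᵥ B) ^ 2 = y ⬝ᵥ z := by
      have : X *ᵥ y = z - (r / (1 + b)) • B := by
        rw [hy, mulVec_sub, mulVec_smul, hXP, hXP]
      rw [this, dotProduct_sub, dotProduct_smul, hyB, smul_eq_mul]
      ring
    have hcross : (Aᵀ *ᵥ y) ⬝ᵥ x = y ⬝ᵥ z := by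
      rw [mulVec_transpose, ← dotProduct_mulVec]
    have hlt := hXA y h0
    generalize Aᵀ *ᵥ y = v at hcross hlt
    -- Completing the square gives `2 y·z ≤ vᵀXv + xᵀX⁻¹x`, while the dual inequality gives `vᵀXv <
    -- y·z`.
    have hsq : 0 ≤ (v - X⁻¹ *ᵥ x) ⬝ᵥ (X *ᵥ (v - X⁻¹ *ᵥ x)) := by
      simpa using hX.posSemidef.dotProduct_mulVec_nonneg (v - X⁻¹ *ᵥ x)
    rw [mulVec_sub, hXP, dotProduct_sub, sub_dotProduct, sub_dotProduct, hcross,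
      hsX (X⁻¹ *ᵥ x) v, hXP, hcross, dotProduct_comm (X⁻¹ *ᵥ x) x] at hsq
    linarith

/-- Solvability of the modified algebraic Riccati equation below the critical value
`1 / M(A)²` of `δ²`. -/
theorem exists_isMARESolution {n : ℕ} {A : Matrix (Fin n) (Fin n) ℝ} {B : Fin n → ℝ}
    (hAB : Stabilizable A B) {δ : ℝ} (hδ0 : 0 < δ ^ 2) (hδ : δ ^ 2 < 1 / mahler A ^ 2) :
    ∃ Q P : Matrix (Fin n) (Fin n) ℝ, Q.PosDef ∧ P.PosDef ∧ IsMARESolution A B δ Q P := by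
  have hM : 0 < mahler A ^ 2 := by
    have : 1 ≤ mahler A := one_le_prod_map_max _
    positivity
  obtain ⟨P, hP, hb, hlt⟩ := exists_riccati_inequality (gam := 1 / δ ^ 2) hAB (by
    rw [lt_div_iff₀ hδ0]
    rw [lt_div_iff₀ hM] at hδ
    linarith)
  have hsP := dotProduct_mulVec_comm_of_isSymm hP.isHermitian
  have hPt : Pᵀ = P := by
    rw [← conjTranspose_eq_transpose_of_trivial, hP.isHermitian.eq]
  set b := B ⬝ᵥ (P *ᵥ B) with hbdef
  have hb0 : 0 ≤ b := by simpa using hP.posSemidef.dotProduct_mulVec_nonneg B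
  have hv : B ᵥ* (P * A) = (Aᵀ * P) *ᵥ B := by
    rw [← mulVec_transpose, transpose_mul, hPt]
  refine ⟨P - (Aᵀ * P * A - ((1 - δ ^ 2) * b⁻¹) • vecMulVec ((Aᵀ * P) *ᵥ B) (B ᵥ* (P * A))), P,
    PosDef.of_dotProduct_mulVec_pos ?_ ?_, hP, ?_⟩
  · rw [IsHermitian, conjTranspose_eq_transpose_of_trivial, hv]
    simp [transpose_sub, transpose_mul, hPt, transpose_smul, transpose_vecMulVec, Matrix.mul_assoc]
  · intro x hx
    have h1 : x ⬝ᵥ ((Aᵀ * P * A) *ᵥ x) = (A *ᵥ x) ⬝ᵥ (P *ᵥ (A *ᵥ x)) := by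
      rw [← mulVec_mulVec, ← mulVec_mulVec, dotProduct_mulVec, vecMul_transpose]
    have h2 : (B ᵥ* (P * A)) ⬝ᵥ x = B ⬝ᵥ (P *ᵥ (A *ᵥ x)) := by
      rw [← dotProduct_mulVec, ← mulVec_mulVec]
    rw [star_trivial, sub_mulVec, sub_mulVec, smul_mulVec, vecMulVec_mulVec_eq_smul, ← hv,
      dotProduct_sub, dotProduct_sub, dotProduct_smul, dotProduct_smul,
      dotProduct_comm x (B ᵥ* (P * A)), h1, h2]
    have hx := hlt x hx
    rcases eq_or_ne B 0 with rfl | hB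
    · simp only [zero_dotProduct] at hx ⊢
      simp at hx ⊢
      linarith
    have hbpos : 0 < b := by simpa using hP.dotProduct_mulVec_pos hB
    -- This is equivalent to `δ² (1 + b) ≤ 1`, the bound with `gam = 1 / δ²`; it compares the
    -- ordinary Riccati term with the modified one.
    have hcoef : 1 / (1 + b) ≤ (1 - δ ^ 2) * b⁻¹ := by
      rw [le_div_iff₀ hδ0] at hb
      rw [← div_eq_mul_inv, div_le_div_iff₀ (by linarith) hbpos]
      nlinarith
    have := mul_le_mul_of_nonneg_right hcoef (sq_nonneg (B ⬝ᵥ (P *ᵥ (A *ᵥ x))))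
    rw [one_div_mul_eq_div] at this
    simp only [smul_eq_mul]
    nlinarith
  · rw [IsMARESolution, ← hbdef]
    abel

end

/-! ### Laplacian of a leader-follower graph. -/

theorem adjacency_of_isChannel {N : ℕ} {G : Digraph (Fin N)} {i j : Fin N}
    (h : IsChannel G i j) : adjacency G i j = 1 := by
  simp [adjacency, h]

theorem adjacency_of_not_isChannel {N : ℕ} {G : Digraph (Fin N)} {i j : Fin N}
    (h : ¬ IsChannel G i j) : adjacency G i j = 0 := by
  simp [adjacency, h]

theorem laplacian_mulVec {N : ℕ} (G : Digraph (Fin N)) (x : Fin N → ℝ) (i : Fin N) :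
    (laplacian G *ᵥ x) i = ∑ j, adjacency G i j * (x i - x j) := by
  have h : ∀ j, laplacian G i j * x j
      = (if i = j then (∑ m, adjacency G i m) * x j else 0) - adjacency G i j * x j := by
    intro j
    by_cases hij : i = j
    · subst hij
      have : adjacency G i i = 0 := adjacency_of_not_isChannel fun h => h.1 rfl
      simp [laplacian, this]
    · simp [laplacian, hij]
  simp only [mulVec, dotProduct, h, Finset.sum_sub_distrib, mul_sub, Finset.sum_ite_eq,
    Finset.mem_univ, if_true, Finset.sum_mul]

namespace IsLeaderFollower

variable {N : ℕ} {G : Digraph (Fin N)} {l : Fin N}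

theorem adjacency_leader (hG : IsLeaderFollower G l) (j : Fin N) : adjacency G l j = 0 :=
  adjacency_of_not_isChannel fun h => hG.leader_no_parent j h.2

theorem isChannel_symm (hG : IsLeaderFollower G l) {i j : Fin N} (hi : i ≠ l) (hj : j ≠ l)
    (h : IsChannel G i j) : IsChannel G j i :=
  ⟨h.1.symm, hG.followers_undirected j i hj hi h.2⟩

theorem adjacency_symm (hG : IsLeaderFollower G l) {i j : Fin N} (hi : i ≠ l) (hj : j ≠ l) :
    adjacency G i j = adjacency G j i := by
  by_cases h : IsChannel G i j
  · rw [adjacency_of_isChannel h, adjacency_of_isChannel (hG.isChannel_symm hi hj h)]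
  · rw [adjacency_of_not_isChannel h,
      adjacency_of_not_isChannel fun h' => h (hG.isChannel_symm hj hi h')]

theorem sum_sum_nonneg {f : Fin N → Fin N → ℝ} (hf : ∀ i j, 0 ≤ f i j + f j i) :
    0 ≤ ∑ i, ∑ j, f i j := by
  have h : 0 ≤ ∑ i, ∑ j, (f i j + f j i) :=
    Finset.sum_nonneg fun i _ => Finset.sum_nonneg fun j _ => hf i j
  simp only [Finset.sum_add_distrib] at h
  rw [Finset.sum_comm (f := fun i j => f j i)] at h
  linarith

/-- The contributions of a pair of agents to the Laplacian form add up to a square. -/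
theorem edge_energy (hG : IsLeaderFollower G l) {x : Fin N → ℝ} (hx : x l = 0) {i j : Fin N}
    (h : IsChannel G i j) :
    x i * (adjacency G i j * (x i - x j)) + x j * (adjacency G j i * (x j - x i))
      = (x i - x j) ^ 2 := by
  have hi : i ≠ l := fun hi => hG.leader_no_parent j (hi ▸ h.2)
  rw [adjacency_of_isChannel h]
  rcases eq_or_ne j l with rfl | hj
  · rw [hx]; ring
  · rw [adjacency_of_isChannel (hG.isChannel_symm hi hj h)]; ring

theorem edge_energy_nonneg (hG : IsLeaderFollower G l) {x : Fin N → ℝ} (hx : x l = 0)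
    (i j : Fin N) :
    0 ≤ x i * (adjacency G i j * (x i - x j)) + x j * (adjacency G j i * (x j - x i)) := by
  by_cases h : IsChannel G i j
  · rw [hG.edge_energy hx h]; positivity
  by_cases h' : IsChannel G j i
  · rw [add_comm, hG.edge_energy hx h']; positivity
  · simp [adjacency_of_not_isChannel h, adjacency_of_not_isChannel h']

theorem dotProduct_laplacian (x : Fin N → ℝ) :
    x ⬝ᵥ (laplacian G *ᵥ x) = ∑ i, ∑ j, x i * (adjacency G i j * (x i - x j)) := by
  simp only [dotProduct, laplacian_mulVec, Finset.mul_sum]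

/-- The Laplacian form is a sum of squares over edges, so `x` is constant along every edge; the
value zero spreads from the leader along directed paths. -/
theorem eq_zero_of_laplacian_mulVec_eq_zero (hG : IsLeaderFollower G l) {x : Fin N → ℝ}
    (hx : x l = 0) (h0 : laplacian G *ᵥ x = 0) : x = 0 := by
  have hsum : ∑ i, ∑ j, (x i * (adjacency G i j * (x i - x j))
      + x j * (adjacency G j i * (x j - x i))) = 0 := by
    have h := dotProduct_laplacian (G := G) x
    rw [h0, dotProduct_zero] at h
    simp only [Finset.sum_add_distrib]
    rw [Finset.sum_comm (f := fun i j => x j * (adjacency G j i * (x j - x i))), ← h, add_zero]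
  have hterm : ∀ i j, x i * (adjacency G i j * (x i - x j))
      + x j * (adjacency G j i * (x j - x i)) = 0 := by
    intro i j
    rw [Finset.sum_eq_zero_iff_of_nonneg
      fun i _ => Finset.sum_nonneg fun j _ => hG.edge_energy_nonneg hx i j] at hsum
    have := hsum i (Finset.mem_univ i)
    rw [Finset.sum_eq_zero_iff_of_nonneg fun j _ => hG.edge_energy_nonneg hx i j] at this
    exact this j (Finset.mem_univ j)
  have hreach : ∀ i, Relation.ReflTransGen G.Adj l i → x i = 0 := by
    intro i hi
    induction hi with
    | refl => exact hx
    | @tail b c _ hbc ih =>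
      rcases eq_or_ne c b with rfl | hne
      · exact ih
      have h := hterm c b
      rw [hG.edge_energy hx ⟨hne, hbc⟩, ih] at h
      simpa using h
  ext i
  exact hreach i (hG.rooted i)

/-- The noise energy is dominated by the Laplacian form. -/
theorem noise_energy_le (hG : IsLeaderFollower G l) {σ : Fin N → Fin N → ℝ} {s : ℝ}
    (hs : ∀ v ∈ channelVariances G l σ, v ≤ s) {x : Fin N → ℝ} (hx : x l = 0) :
    ∑ i, ∑ j, adjacency G i j * (σ i j ^ 2 * (x i - x j) ^ 2)
      ≤ s * (x ⬝ᵥ (laplacian G *ᵥ x)) := by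
  have key : ∀ i j, IsChannel G i j →
      0 ≤ (s * (x i * (adjacency G i j * (x i - x j)))
          - adjacency G i j * (σ i j ^ 2 * (x i - x j) ^ 2))
        + (s * (x j * (adjacency G j i * (x j - x i)))
          - adjacency G j i * (σ j i ^ 2 * (x j - x i) ^ 2)) := by
    intro i j h
    have hi : i ≠ l := fun hi => hG.leader_no_parent j (hi ▸ h.2)
    have he := hG.edge_energy hx h
    have hsq := sq_nonneg (x i - x j)
    -- A leader edge carries noise in one direction only, a follower pair in both; hence the two
    -- kinds of values in `channelVariances`.
    rcases eq_or_ne j l with rfl | hj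
    · have hsv := hs (σ i j ^ 2) (Or.inl ⟨i, hi, h, rfl⟩)
      have := mul_le_mul_of_nonneg_right hsv hsq
      rw [hG.adjacency_leader, adjacency_of_isChannel h] at he ⊢
      nlinarith
    · have hsv := hs (σ i j ^ 2 + σ j i ^ 2) (Or.inr ⟨i, j, hi, hj, h, rfl⟩)
      have := mul_le_mul_of_nonneg_right hsv hsq
      rw [adjacency_of_isChannel (hG.isChannel_symm hi hj h), adjacency_of_isChannel h] at he ⊢
      nlinarith
  have h := sum_sum_nonneg (f := fun i j => s * (x i * (adjacency G i j * (x i - x j)))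
      - adjacency G i j * (σ i j ^ 2 * (x i - x j) ^ 2)) (by
    intro i j
    by_cases h : IsChannel G i j
    · exact key i j h
    by_cases h' : IsChannel G j i
    · rw [add_comm]
      exact key j i h'
    · simp [adjacency_of_not_isChannel h, adjacency_of_not_isChannel h'])
  rw [dotProduct_laplacian, Finset.mul_sum]
  simp only [Finset.sum_sub_distrib, ← Finset.mul_sum] at h
  simp only [← Finset.mul_sum] at h ⊢
  linarith

/-- The Laplacian with the column of the leader removed. -/
def followerLaplacian (G : Digraph (Fin N)) (l : Fin N) : Matrix (Fin N) (Fin N) ℝ :=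
  Matrix.of fun i j => if j = l then 0 else laplacian G i j

/-- The leader's row is already zero, so deleting its column restores symmetry and makes the
spectral theorem available. -/
theorem isHermitian_followerLaplacian (hG : IsLeaderFollower G l) :
    (followerLaplacian G l).IsHermitian := by
  have hrow : ∀ j, laplacian G l j = 0 := fun j => by
    simp [laplacian, hG.adjacency_leader]
  ext i j
  simp only [conjTranspose_apply, followerLaplacian, of_apply, star_trivial]
  rcases eq_or_ne i l with rfl | hi
  · simp [hrow]
  rcases eq_or_ne j l with rfl | hj
  · simp [hrow]
  rw [if_neg hi, if_neg hj]
  rcases eq_or_ne i j with rfl | hij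
  · rfl
  · simp [laplacian, hij, hij.symm, hG.adjacency_symm hi hj]

theorem followerLaplacian_mulVec {x : Fin N → ℝ} (hx : x l = 0) :
    followerLaplacian G l *ᵥ x = laplacian G *ᵥ x := by
  ext i
  rw [mulVec, mulVec, dotProduct, dotProduct]
  refine Finset.sum_congr rfl fun j _ => ?_
  rcases eq_or_ne j l with rfl | hj
  · simp [hx]
  · simp [followerLaplacian, hj]

/-- A kernel vector is supported at the leader, hence orthogonal to `x`; so `c ≠ 0`. The zero leader
row then forces `v l = 0`, where the two matrices act alike. -/
theorem mem_nonzeroEigenvalues_of_eigenvector (hG : IsLeaderFollower G l) {x v : Fin N → ℝ}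
    (hx : x l = 0) {c : ℝ} (hv : followerLaplacian G l *ᵥ v = c • v) (hvx : v ⬝ᵥ x ≠ 0) :
    c ∈ nonzeroEigenvalues G := by
  have hc : c ≠ 0 := by
    rintro rfl
    rw [zero_smul] at hv
    have h1 : followerLaplacian G l *ᵥ (Function.update v l 0) = 0 := by
      rw [← hv]
      ext i
      rw [mulVec, mulVec, dotProduct, dotProduct]
      refine Finset.sum_congr rfl fun j _ => ?_
      rcases eq_or_ne j l with rfl | hj
      · simp [followerLaplacian]
      · simp [hj]
    rw [followerLaplacian_mulVec (by simp)] at h1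
    have h2 := hG.eq_zero_of_laplacian_mulVec_eq_zero (by simp) h1
    refine hvx (Finset.sum_eq_zero fun i _ => ?_)
    rcases eq_or_ne i l with rfl | hi
    · simp [hx]
    · have := congrFun h2 i
      rw [Function.update_of_ne hi] at this
      simp [this]
  have hvl : v l = 0 := by
    have h1 := congrFun hv l
    have h2 : (followerLaplacian G l *ᵥ v) l = 0 := by
      rw [mulVec, dotProduct]
      refine Finset.sum_eq_zero fun j _ => ?_
      simp [followerLaplacian, laplacian, hG.adjacency_leader]
    rw [h2, Pi.smul_apply, smul_eq_mul] at h1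
    exact (mul_eq_zero.1 h1.symm).resolve_left hc
  refine ⟨hc, Module.End.hasEigenvalue_of_hasEigenvector (x := v)
    (Module.End.hasEigenvector_iff.2 ⟨?_, ?_⟩)⟩
  · rw [Module.End.mem_eigenspace_iff, toLin'_apply, ← followerLaplacian_mulVec hvl, hv]
  · rintro rfl
    simp at hvx

/-- Convexity in the eigenvalue; `h3` is the convexity defect of the quadratic. -/
theorem quadratic_le_of_endpoints {al s d a b c : ℝ} (ha : (al * a - 1) ^ 2 + al ^ 2 * s * a ≤ d)
    (hb : (al * b - 1) ^ 2 + al ^ 2 * s * b ≤ d) (hac : a ≤ c) (hcb : c ≤ b) :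
    (al * c - 1) ^ 2 + al ^ 2 * s * c ≤ d := by
  rcases eq_or_lt_of_le hac with rfl | hac'
  · exact ha
  have hab : 0 < b - a := by linarith
  have h1 := mul_le_mul_of_nonneg_left ha (sub_nonneg.2 hcb)
  have h2 := mul_le_mul_of_nonneg_left hb (sub_nonneg.2 hac)
  have h3 : 0 ≤ al ^ 2 * ((b - a) * ((b - c) * (c - a))) :=
    mul_nonneg (sq_nonneg _) (mul_nonneg hab.le (mul_nonneg (by linarith) (by linarith)))
  refine le_of_mul_le_mul_left ?_ hab
  linarith

/-- Spectral bound of the disagreement dynamics. -/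
theorem laplacian_form_le (hG : IsLeaderFollower G l) {lam2 lamN al s d : ℝ}
    (hlam2 : IsLeast (nonzeroEigenvalues G) lam2)
    (hlamN : IsGreatest (nonzeroEigenvalues G) lamN)
    (h2 : (al * lam2 - 1) ^ 2 + al ^ 2 * s * lam2 ≤ d)
    (hN : (al * lamN - 1) ^ 2 + al ^ 2 * s * lamN ≤ d)
    {x : Fin N → ℝ} (hx : x l = 0) :
    al ^ 2 * ((laplacian G *ᵥ x) ⬝ᵥ (laplacian G *ᵥ x)) - 2 * al * (x ⬝ᵥ (laplacian G *ᵥ x))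
      + x ⬝ᵥ x + al ^ 2 * s * (x ⬝ᵥ (laplacian G *ᵥ x)) ≤ d * (x ⬝ᵥ x) := by
  have hH := hG.isHermitian_followerLaplacian
  set v : Fin N → Fin N → ℝ := fun k => (hH.eigenvectorBasis k).ofLp with hv
  have hparseval : ∀ y z : Fin N → ℝ, y ⬝ᵥ z = ∑ k, (v k ⬝ᵥ y) * (v k ⬝ᵥ z) := by
    intro y z
    have h := hH.eigenvectorBasis.sum_inner_mul_inner (WithLp.toLp 2 y) (WithLp.toLp 2 z)
    simp only [EuclideanSpace.inner_eq_star_dotProduct, star_trivial] at h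
    rw [dotProduct_comm, ← h]
    refine Finset.sum_congr rfl fun k _ => ?_
    rw [dotProduct_comm z]
  have heig : ∀ k, followerLaplacian G l *ᵥ v k = hH.eigenvalues k • v k :=
    hH.mulVec_eigenvectorBasis
  have hcoord : ∀ k, v k ⬝ᵥ (laplacian G *ᵥ x) = hH.eigenvalues k * (v k ⬝ᵥ x) := by
    intro k
    rw [← followerLaplacian_mulVec hx, dotProduct_mulVec_comm_of_isSymm hH, heig,
      dotProduct_smul, smul_eq_mul, dotProduct_comm]
  rw [hparseval x x, hparseval x (laplacian G *ᵥ x),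
    hparseval (laplacian G *ᵥ x) (laplacian G *ᵥ x)]
  simp only [hcoord, Finset.mul_sum]
  rw [← Finset.sum_sub_distrib, ← Finset.sum_add_distrib, ← Finset.sum_add_distrib]
  refine Finset.sum_le_sum fun k _ => ?_
  rcases eq_or_ne (v k ⬝ᵥ x) 0 with h0 | h0
  · simp [h0]
  have hmem := hG.mem_nonzeroEigenvalues_of_eigenvector hx (heig k) h0
  have hq := quadratic_le_of_endpoints h2 hN (hlam2.2 hmem) (hlamN.2 hmem)
  have := mul_le_mul_of_nonneg_right hq (sq_nonneg (v k ⬝ᵥ x))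
  linarith

/-- Contraction of the relative feedback together with the noise energy. -/
theorem feedback_energy_le (hG : IsLeaderFollower G l) {σ : Fin N → Fin N → ℝ}
    {lam2 lamN al s d : ℝ}
    (hlam2 : IsLeast (nonzeroEigenvalues G) lam2)
    (hlamN : IsGreatest (nonzeroEigenvalues G) lamN)
    (hs : ∀ v ∈ channelVariances G l σ, v ≤ s)
    (h2 : (al * lam2 - 1) ^ 2 + al ^ 2 * s * lam2 ≤ d)
    (hN : (al * lamN - 1) ^ 2 + al ^ 2 * s * lamN ≤ d)
    {x : Fin N → ℝ} (hx : x l = 0) :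
    ∑ i, (al ^ 2 * (∑ j, adjacency G i j * (x i - x j)) ^ 2
        - 2 * al * (x i * ∑ j, adjacency G i j * (x i - x j))
        + al ^ 2 * ∑ j, adjacency G i j * (σ i j ^ 2 * (x i - x j) ^ 2))
      ≤ -((1 - d) * ∑ i, x i ^ 2) := by
  have h1 := hG.laplacian_form_le hlam2 hlamN h2 hN hx
  have h3 := mul_le_mul_of_nonneg_left (hG.noise_energy_le hs hx) (sq_nonneg al)
  have hxx : x ⬝ᵥ x = ∑ i, x i ^ 2 := Finset.sum_congr rfl fun i _ => (sq (x i)).symm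
  have hLL : (laplacian G *ᵥ x) ⬝ᵥ (laplacian G *ᵥ x)
      = ∑ i, (∑ j, adjacency G i j * (x i - x j)) ^ 2 :=
    Finset.sum_congr rfl fun i _ => by rw [laplacian_mulVec, sq]
  have hxL : x ⬝ᵥ (laplacian G *ᵥ x) = ∑ i, x i * ∑ j, adjacency G i j * (x i - x j) :=
    Finset.sum_congr rfl fun i _ => by rw [laplacian_mulVec]
  rw [hxx, hLL, hxL] at h1
  rw [hxL] at h3
  simp only [Finset.sum_add_distrib, Finset.sum_sub_distrib, ← Finset.mul_sum]
  linarith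

end IsLeaderFollower

/-! ### Comparison of forms, independence and second moments. -/

theorem exists_mul_form_le {n : ℕ} {P Q : Matrix (Fin n) (Fin n) ℝ} (hP : P.PosDef)
    (hQ : Q.PosDef) :
    ∃ c : ℝ, 0 < c ∧ c ≤ 1 ∧ ∀ x, c * (x ⬝ᵥ (P *ᵥ x)) ≤ x ⬝ᵥ (Q *ᵥ x) := by
  have hform : ∀ {M : Matrix (Fin n) (Fin n) ℝ} (hM : M.IsHermitian) (x : Fin n → ℝ),
      x ⬝ᵥ (M *ᵥ x) = ∑ k, hM.eigenvalues k * ((hM.eigenvectorBasis k).ofLp ⬝ᵥ x) ^ 2 ∧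
      x ⬝ᵥ x = ∑ k, ((hM.eigenvectorBasis k).ofLp ⬝ᵥ x) ^ 2 := by
    intro M hM x
    have hpars : ∀ y z : Fin n → ℝ, y ⬝ᵥ z
        = ∑ k, ((hM.eigenvectorBasis k).ofLp ⬝ᵥ y) * ((hM.eigenvectorBasis k).ofLp ⬝ᵥ z) := by
      intro y z
      have h := hM.eigenvectorBasis.sum_inner_mul_inner (WithLp.toLp 2 y) (WithLp.toLp 2 z)
      simp only [EuclideanSpace.inner_eq_star_dotProduct, star_trivial] at h
      rw [dotProduct_comm, ← h]
      refine Finset.sum_congr rfl fun k _ => ?_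
      rw [dotProduct_comm z]
    constructor
    · rw [hpars]
      refine Finset.sum_congr rfl fun k _ => ?_
      rw [dotProduct_mulVec_comm_of_isSymm hM _ x, hM.mulVec_eigenvectorBasis,
        dotProduct_smul, smul_eq_mul, dotProduct_comm x]
      ring
    · rw [hpars]
      exact Finset.sum_congr rfl fun k _ => (sq _).symm
  have hμ := hP.eigenvalues_pos
  have hν := hQ.eigenvalues_pos
  set C : ℝ := 1 + ∑ k, hP.isHermitian.eigenvalues k with hC
  set D : ℝ := 1 + ∑ k, (hQ.isHermitian.eigenvalues k)⁻¹ with hD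
  have hC1 : 1 ≤ C := le_add_of_nonneg_right (Finset.sum_nonneg fun k _ => (hμ k).le)
  have hD1 : 1 ≤ D := le_add_of_nonneg_right (Finset.sum_nonneg fun k _ => (inv_pos.2 (hν k)).le)
  have hupper : ∀ x, x ⬝ᵥ (P *ᵥ x) ≤ C * (x ⬝ᵥ x) := by
    intro x
    rw [(hform hP.isHermitian x).1, (hform hP.isHermitian x).2, Finset.mul_sum]
    refine Finset.sum_le_sum fun k _ => mul_le_mul_of_nonneg_right ?_ (sq_nonneg _)
    have := Finset.single_le_sum (fun k _ => (hμ k).le) (Finset.mem_univ k)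
    linarith
  have hlower : ∀ x, x ⬝ᵥ x ≤ D * (x ⬝ᵥ (Q *ᵥ x)) := by
    intro x
    rw [(hform hQ.isHermitian x).1, (hform hQ.isHermitian x).2, Finset.mul_sum]
    refine Finset.sum_le_sum fun k _ => ?_
    rw [← mul_assoc]
    refine le_mul_of_one_le_left (sq_nonneg _) ?_
    have h1 := Finset.single_le_sum (f := fun k => (hQ.isHermitian.eigenvalues k)⁻¹)
      (fun k _ => (inv_pos.2 (hν k)).le) (Finset.mem_univ k)
    have h2 : (hQ.isHermitian.eigenvalues k)⁻¹ ≤ D := by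
      linarith
    have h3 := mul_le_mul_of_nonneg_right h2 (hν k).le
    rwa [inv_mul_cancel₀ (hν k).ne'] at h3
  -- `C` dominates the eigenvalues of `P`, and `D` the inverses of those of `Q`. The added ones give
  -- `C, D ≥ 1`, hence `c ≤ 1`, which keeps the later contraction factor `1 - c` nonnegative.
  refine ⟨(C * D)⁻¹, by positivity, inv_le_one_of_one_le₀ (one_le_mul_of_one_le_of_one_le hC1 hD1),
    fun x => ?_⟩
  rw [inv_mul_le_iff₀ (by positivity), mul_assoc]
  exact (hupper x).trans (mul_le_mul_of_nonneg_left (hlower x) (by linarith))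

theorem _root_.ProbabilityTheory.IndepFun.prodMk_left_of_right {Ω S T U : Type*}
    [MeasurableSpace Ω] [MeasurableSpace S] [MeasurableSpace T] [MeasurableSpace U]
    {μ : Measure Ω} [IsProbabilityMeasure μ] {X : Ω → S} {Y : Ω → T} {Z : Ω → U}
    (hX : AEMeasurable X μ) (hY : AEMeasurable Y μ) (hZ : AEMeasurable Z μ)
    (hXYZ : IndepFun X (fun ω => (Y ω, Z ω)) μ) (hYZ : IndepFun Y Z μ) :
    IndepFun (fun ω => (X ω, Y ω)) Z μ := by
  have hXY : IndepFun X Y μ := hXYZ.comp measurable_id measurable_fst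
  have h1 := (indepFun_iff_map_prod_eq_prod_map_map hX (hY.prodMk hZ)).1 hXYZ
  rw [(indepFun_iff_map_prod_eq_prod_map_map hY hZ).1 hYZ] at h1
  have := Measure.isProbabilityMeasure_map (μ := μ) hX
  have := Measure.isProbabilityMeasure_map (μ := μ) hY
  have := Measure.isProbabilityMeasure_map (μ := μ) hZ
  rw [indepFun_iff_map_prod_eq_prod_map_map (hX.prodMk hY) hZ,
    (indepFun_iff_map_prod_eq_prod_map_map hX hY).1 hXY]
  have h2 : Measure.map (MeasurableEquiv.prodAssoc (α := S) (β := T) (γ := U))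
      (((μ.map X).prod (μ.map Y)).prod (μ.map Z)) = (μ.map X).prod ((μ.map Y).prod (μ.map Z)) :=
    (measurePreserving_prodAssoc _ _ _).map_eq
  have h3 : μ.map (fun ω => ((X ω, Y ω), Z ω))
      = (μ.map (fun ω => (X ω, (Y ω, Z ω)))).map (MeasurableEquiv.prodAssoc.symm) := by
    rw [AEMeasurable.map_map_of_aemeasurable (MeasurableEquiv.measurable _).aemeasurable
      (hX.prodMk (hY.prodMk hZ))]
    rfl
  rw [h3, h1, ← h2, Measure.map_map (MeasurableEquiv.measurable _) (MeasurableEquiv.measurable _)]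
  simp

theorem integrable_mul_of_memLp_two {Ω : Type*} [MeasurableSpace Ω] {μ : Measure Ω}
    {f g : Ω → ℝ} (hf : MemLp f 2 μ) (hg : MemLp g 2 μ) :
    Integrable (fun ω => f ω * g ω) μ :=
  hf.integrable_mul hg

/-- Independence makes the square of the product a product of independent integrable functions, so
second moments suffice. -/
theorem memLp_two_mul_of_indepFun {Ω S ι : Type*} [MeasurableSpace Ω] [MeasurableSpace S]
    {μ : Measure Ω} {X : Ω → S} {W : Ω → ι → ℝ} (hXW : IndepFun X W μ)
    {d : S → ℝ} (hd : Measurable d) (hd2 : MemLp (fun ω => d (X ω)) 2 μ) {i : ι}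
    (hW : MemLp (fun ω => W ω i) 2 μ) : MemLp (fun ω => W ω i * d (X ω)) 2 μ := by
  have hi : IndepFun (fun ω => d (X ω) ^ 2) (fun ω => W ω i ^ 2) μ :=
    hXW.comp (φ := fun x => d x ^ 2) (ψ := fun w : ι → ℝ => w i ^ 2) (hd.pow_const 2) (by fun_prop)
  have hm : AEStronglyMeasurable (fun ω => W ω i * d (X ω)) μ :=
    hW.aestronglyMeasurable.mul hd2.aestronglyMeasurable
  rw [memLp_two_iff_integrable_sq hm]
  refine (hi.integrable_mul hd2.integrable_sq hW.integrable_sq).congr (ae_of_all _ fun ω => ?_)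
  simp only [Pi.mul_apply]
  ring

section Moments

variable {Ω S ι : Type*} [MeasurableSpace Ω] [MeasurableSpace S] [Fintype ι]
  {μ : Measure Ω} {X : Ω → S} {W : Ω → ι → ℝ}

/-- A combination of centered noises with independent square integrable coefficients is
uncorrelated with every square integrable function of the coefficients' source. -/
theorem integral_noise_mul_eq_zero (hX : AEMeasurable X μ) (hW : AEMeasurable W μ)
    (hXW : IndepFun X W μ)
    {d : ι → S → ℝ} (hd : ∀ i, Measurable (d i)) (hd2 : ∀ i, MemLp (fun ω => d i (X ω)) 2 μ)
    (hW2 : ∀ i, MemLp (fun ω => W ω i) 2 μ) (hmean : ∀ i, ∫ ω, W ω i ∂μ = 0)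
    {g : S → ℝ} (hg : Measurable g) (hg2 : MemLp (fun ω => g (X ω)) 2 μ) :
    ∫ ω, (∑ i, W ω i * d i (X ω)) * g (X ω) ∂μ = 0 := by
  simp only [Finset.sum_mul]
  rw [integral_finsetSum _ fun i _ =>
    integrable_mul_of_memLp_two
      (memLp_two_mul_of_indepFun hXW (hd i) (hd2 i) (hW2 i)) hg2]
  refine Finset.sum_eq_zero fun i _ => ?_
  have h := hXW.integral_fun_comp_mul_comp (f := fun x => d i x * g x) (g := fun w : ι → ℝ => w i) hX hW
    ((hd i).mul hg).aestronglyMeasurable (measurable_pi_apply i).aestronglyMeasurable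
  rw [hmean, mul_zero] at h
  rw [← h]
  exact integral_congr_ae (ae_of_all _ fun ω => by ring)

/-- Expanding the square, each term factors by independence of `X` and `W`; pairwise orthogonality
of the noises kills the off-diagonal ones. -/
theorem integral_noise_sq (hX : AEMeasurable X μ) (hW : AEMeasurable W μ)
    (hXW : IndepFun X W μ)
    {d : ι → S → ℝ} (hd : ∀ i, Measurable (d i)) (hd2 : ∀ i, MemLp (fun ω => d i (X ω)) 2 μ)
    (hW2 : ∀ i, MemLp (fun ω => W ω i) 2 μ)
    (horth : ∀ i j, i ≠ j → ∫ ω, W ω i * W ω j ∂μ = 0)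
    {v : ι → ℝ} (hvar : ∀ i, ∫ ω, W ω i ^ 2 ∂μ = v i) :
    ∫ ω, (∑ i, W ω i * d i (X ω)) ^ 2 ∂μ = ∑ i, v i * ∫ ω, d i (X ω) ^ 2 ∂μ := by
  have hLp := fun i => memLp_two_mul_of_indepFun hXW (hd i) (hd2 i) (hW2 i)
  have hpair : ∀ i j, ∫ ω, (W ω i * d i (X ω)) * (W ω j * d j (X ω)) ∂μ
      = (∫ ω, d i (X ω) * d j (X ω) ∂μ) * ∫ ω, W ω i * W ω j ∂μ := by
    intro i j
    have h := hXW.integral_fun_comp_mul_comp (f := fun x => d i x * d j x)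
      (g := fun w : ι → ℝ => w i * w j) hX hW ((hd i).mul (hd j)).aestronglyMeasurable
      ((measurable_pi_apply i).mul (measurable_pi_apply j)).aestronglyMeasurable
    rw [← h]
    exact integral_congr_ae (ae_of_all _ fun ω => by ring)
  simp only [sq (∑ i, _), Finset.sum_mul_sum]
  rw [integral_finsetSum _ fun i _ => integrable_finsetSum _ fun j _ =>
    integrable_mul_of_memLp_two (hLp i) (hLp j)]
  refine Finset.sum_congr rfl fun i _ => ?_
  rw [integral_finsetSum _ fun j _ => integrable_mul_of_memLp_two (hLp i) (hLp j),
    Finset.sum_eq_single_of_mem i (Finset.mem_univ i)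
      fun j _ hji => by rw [hpair, horth i j hji.symm, mul_zero], hpair, ← hvar i, mul_comm]
  simp only [sq]

end Moments

/-! ### Causality: the state depends only on past uncertainties. -/

variable {N n : ℕ}

/-- The uncertainties on the channels at one time, zero off the channels. -/
def maskedNoise (G : Digraph (Fin N)) (D : Fin N → Fin N → ℝ) (p : Fin N × Fin N) : ℝ :=
  adjacency G p.1 p.2 * D p.1 p.2

open Classical in
/-- The uncertainties at all times read off from values on the channels. -/
def channelPath (G : Digraph (Fin N))
    (d : {e : Fin N × Fin N // IsChannel G e.1 e.2} × ℕ → ℝ) (t : ℕ) (i j : Fin N) : ℝ :=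
  if h : IsChannel G i j then d (⟨(i, j), h⟩, t) else 0

theorem controlInput_congr {G : Digraph (Fin N)} {l : Fin N} {α : ℝ} {K : Fin n → ℝ}
    {D D' : Fin N → Fin N → ℝ} (h : ∀ i j, IsChannel G i j → D i j = D' i j)
    (x : Fin N → Fin n → ℝ) (i : Fin N) :
    controlInput G l α K D x i = controlInput G l α K D' x i := by
  have : ∀ j, adjacency G i j * (1 + D i j) = adjacency G i j * (1 + D' i j) := fun j => by
    by_cases hc : IsChannel G i j
    · rw [h i j hc]
    · simp [adjacency_of_not_isChannel hc]
  simp only [controlInput, this]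

theorem trajectory_congr {A : Matrix (Fin n) (Fin n) ℝ} {B : Fin n → ℝ} {G : Digraph (Fin N)}
    {l : Fin N} {α : ℝ} {K : Fin n → ℝ} {D D' : ℕ → Fin N → Fin N → ℝ}
    (x0 : Fin N → Fin n → ℝ) (k : ℕ)
    (h : ∀ t < k, ∀ i j, IsChannel G i j → D t i j = D' t i j) :
    trajectory A B G l α K D x0 k = trajectory A B G l α K D' x0 k := by
  induction k with
  | zero => rfl
  | succ k ih =>
    rw [trajectory, trajectory, ih fun t ht => h t (by omega)]
    simp only [controlInput_congr (h k (by omega))]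

theorem measurable_trajectory (A : Matrix (Fin n) (Fin n) ℝ) (B : Fin n → ℝ)
    (G : Digraph (Fin N)) (l : Fin N) (α : ℝ) (K : Fin n → ℝ) (k : ℕ) :
    Measurable fun p : (Fin N → Fin n → ℝ) × (ℕ → Fin N → Fin N → ℝ) =>
      trajectory A B G l α K p.2 p.1 k := by
  induction k with
  | zero => exact measurable_fst
  | succ k ih =>
    have hc : ∀ i a, Measurable fun p : (Fin N → Fin n → ℝ) × (ℕ → Fin N → Fin N → ℝ) =>
        trajectory A B G l α K p.2 p.1 k i a := fun i a =>
      (measurable_pi_apply a).comp ((measurable_pi_apply i).comp ih)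
    refine measurable_pi_lambda _ fun i => measurable_pi_lambda _ fun a => ?_
    simp only [trajectory, controlInput, Pi.add_apply, Pi.smul_apply, Pi.sub_apply, mulVec,
      dotProduct, smul_eq_mul]
    split_ifs <;> fun_prop

open Classical in
/-- The states at time `k` are a measurable function of the initial states and of the
uncertainties before time `k`. -/
theorem exists_measurable_factor {Ω : Type*} (A : Matrix (Fin n) (Fin n) ℝ) (B : Fin n → ℝ)
    (G : Digraph (Fin N)) (l : Fin N) (α : ℝ) (K : Fin n → ℝ) (Δ : ℕ → Fin N → Fin N → Ω → ℝ)
    (x0 : Ω → Fin N → Fin n → ℝ) (k : ℕ) :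
    ∃ g : (Fin N → Fin n → ℝ) ×
        ({p // p ∈ (Finset.univ : Finset {e : Fin N × Fin N // IsChannel G e.1 e.2}) ×ˢ
          Finset.range k} → ℝ) → (Fin N → Fin n → ℝ),
      Measurable g ∧ ∀ ω, trajectory A B G l α K (fun t a b => Δ t a b ω) (x0 ω) k
        = g (x0 ω, fun p => noiseFamily G Δ p ω) := by
  set T := (Finset.univ : Finset {e : Fin N × Fin N // IsChannel G e.1 e.2}) ×ˢ Finset.range k
    with hT
  let ext : ({p // p ∈ T} → ℝ) → ({e : Fin N × Fin N // IsChannel G e.1 e.2} × ℕ → ℝ) :=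
    fun f p => if h : p ∈ T then f ⟨p, h⟩ else 0
  have hext : Measurable fun f => channelPath G (ext f) := by
    refine measurable_pi_lambda _ fun t => measurable_pi_lambda _ fun i =>
      measurable_pi_lambda _ fun j => ?_
    by_cases hc : IsChannel G i j
    · by_cases hp : ((⟨(i, j), hc⟩, t) : {e : Fin N × Fin N // IsChannel G e.1 e.2} × ℕ) ∈ T
      · simpa only [channelPath, ext, hc, hp, dif_pos] using measurable_pi_apply _
      · simp only [channelPath, ext, hc, hp, dif_pos, dif_neg, not_false_eq_true]
        exact measurable_const
    · simp only [channelPath, hc, dif_neg, not_false_eq_true]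
      exact measurable_const
  refine ⟨fun p => trajectory A B G l α K (channelPath G (ext p.2)) p.1 k,
    (measurable_trajectory A B G l α K k).comp
      (measurable_fst.prodMk (hext.comp measurable_snd)), fun ω => ?_⟩
  refine trajectory_congr _ _ fun t ht i j hc => ?_
  have hp : ((⟨(i, j), hc⟩, t) : {e : Fin N × Fin N // IsChannel G e.1 e.2} × ℕ) ∈ T := by
    simp [hT, ht]
  simp only [channelPath, ext, hc, hp, dif_pos, noiseFamily]

section Noise

variable {Ω : Type*} [MeasurableSpace Ω] {μ : Measure Ω}
  {G : Digraph (Fin N)} {σ : Fin N → Fin N → ℝ} {Δ : ℕ → Fin N → Fin N → Ω → ℝ}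

namespace IsChannelNoise

theorem aemeasurable_noiseFamily (hΔ : IsChannelNoise G σ μ Δ)
    (p : {e : Fin N × Fin N // IsChannel G e.1 e.2} × ℕ) :
    AEMeasurable (noiseFamily G Δ p) μ :=
  (hΔ.memLp p.2 p.1.1.1 p.1.1.2 p.1.2).aestronglyMeasurable.aemeasurable

theorem memLp_maskedNoise (hΔ : IsChannelNoise G σ μ Δ) (k : ℕ) (p : Fin N × Fin N) :
    MemLp (fun ω => maskedNoise G (fun a b => Δ k a b ω) p) 2 μ := by
  by_cases h : IsChannel G p.1 p.2
  · simpa [maskedNoise, adjacency_of_isChannel h] using hΔ.memLp k p.1 p.2 h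
  · simp [maskedNoise, adjacency_of_not_isChannel h]

theorem integral_maskedNoise (hΔ : IsChannelNoise G σ μ Δ) (k : ℕ) (p : Fin N × Fin N) :
    ∫ ω, maskedNoise G (fun a b => Δ k a b ω) p ∂μ = 0 := by
  by_cases h : IsChannel G p.1 p.2
  · simpa [maskedNoise, adjacency_of_isChannel h] using hΔ.mean k p.1 p.2 h
  · simp [maskedNoise, adjacency_of_not_isChannel h]

theorem integral_maskedNoise_sq (hΔ : IsChannelNoise G σ μ Δ) (k : ℕ) (p : Fin N × Fin N) :
    ∫ ω, maskedNoise G (fun a b => Δ k a b ω) p ^ 2 ∂μ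
      = adjacency G p.1 p.2 * σ p.1 p.2 ^ 2 := by
  by_cases h : IsChannel G p.1 p.2
  · simpa [maskedNoise, adjacency_of_isChannel h] using hΔ.variance k p.1 p.2 h
  · simp [maskedNoise, adjacency_of_not_isChannel h]

theorem integral_maskedNoise_mul (hΔ : IsChannelNoise G σ μ Δ) (k : ℕ) {p q : Fin N × Fin N}
    (hpq : p ≠ q) :
    ∫ ω, maskedNoise G (fun a b => Δ k a b ω) p * maskedNoise G (fun a b => Δ k a b ω) q ∂μ
      = 0 := by
  by_cases hp : IsChannel G p.1 p.2
  swap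
  · simp [maskedNoise, adjacency_of_not_isChannel hp]
  by_cases hq : IsChannel G q.1 q.2
  swap
  · simp [maskedNoise, adjacency_of_not_isChannel hq]
  have hind := hΔ.indep.indepFun (i := (⟨p, hp⟩, k)) (j := (⟨q, hq⟩, k)) (by simpa using hpq)
  have h := hind.integral_mul_eq_mul_integral
    (hΔ.aemeasurable_noiseFamily _).aestronglyMeasurable
    (hΔ.aemeasurable_noiseFamily _).aestronglyMeasurable
  have h0 : ∫ ω, noiseFamily G Δ (⟨p, hp⟩, k) ω ∂μ = 0 := hΔ.mean k p.1 p.2 hp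
  rw [h0, zero_mul] at h
  simpa [maskedNoise, adjacency_of_isChannel hp, adjacency_of_isChannel hq, noiseFamily] using h

variable {A : Matrix (Fin n) (Fin n) ℝ} {B : Fin n → ℝ} {l : Fin N} {α : ℝ} {K : Fin n → ℝ}
  {x0 : Ω → Fin N → Fin n → ℝ}

theorem aemeasurable_trajectory (hΔ : IsChannelNoise G σ μ Δ) (hx0 : AEMeasurable x0 μ) (k : ℕ) :
    AEMeasurable (fun ω => trajectory A B G l α K (fun t a b => Δ t a b ω) (x0 ω) k) μ := by
  obtain ⟨g, hg, hfac⟩ := exists_measurable_factor A B G l α K Δ x0 k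
  simp only [hfac]
  exact hg.comp_aemeasurable (hx0.prodMk
    (aemeasurable_pi_lambda _ fun p => hΔ.aemeasurable_noiseFamily p))

-- The blocks `T` (times before `k`) and `S` (time `k`) are disjoint, hence independent, and `x0` is
-- independent of both jointly. So `(x0, T)`, which determines the state at time `k`, is independent
-- of `S`.
open Classical in
theorem indepFun_trajectory_maskedNoise [IsProbabilityMeasure μ] (hΔ : IsChannelNoise G σ μ Δ) (hx0 : AEMeasurable x0 μ)
    (hind : IndepFun x0 (fun ω p => noiseFamily G Δ p ω) μ) (k : ℕ) :
    IndepFun (fun ω => trajectory A B G l α K (fun t a b => Δ t a b ω) (x0 ω) k)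
      (fun ω => maskedNoise G (fun a b => Δ k a b ω)) μ := by
  obtain ⟨g, hg, hfac⟩ := exists_measurable_factor A B G l α K Δ x0 k
  set T := (Finset.univ : Finset {e : Fin N × Fin N // IsChannel G e.1 e.2}) ×ˢ Finset.range k
  set S := (Finset.univ : Finset {e : Fin N × Fin N // IsChannel G e.1 e.2}) ×ˢ {k} with hS
  have hdisj : Disjoint T S := by
    rw [Finset.disjoint_left]
    rintro ⟨e, t⟩ h1 h2
    simp [T, S] at h1 h2
    omega
  have hTS := hΔ.indep.indepFun_finset₀ T S hdisj hΔ.aemeasurable_noiseFamily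
  have hTm : AEMeasurable (fun ω (p : T) => noiseFamily G Δ p ω) μ :=
    aemeasurable_pi_lambda _ fun p => hΔ.aemeasurable_noiseFamily p
  have hSm : AEMeasurable (fun ω (p : S) => noiseFamily G Δ p ω) μ :=
    aemeasurable_pi_lambda _ fun p => hΔ.aemeasurable_noiseFamily p
  have hsplit : Measurable fun d : {e : Fin N × Fin N // IsChannel G e.1 e.2} × ℕ → ℝ =>
      ((fun p : T => d p), fun p : S => d p) :=
    Measurable.prodMk (by fun_prop) (by fun_prop)
  have hX : IndepFun x0
      (fun ω => ((fun p : T => noiseFamily G Δ p ω), fun p : S => noiseFamily G Δ p ω)) μ :=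
    hind.comp measurable_id hsplit
  have h := IndepFun.prodMk_left_of_right hx0 hTm hSm hX hTS
  let w : ({p // p ∈ S} → ℝ) → Fin N × Fin N → ℝ := fun f p =>
    if hp : IsChannel G p.1 p.2 then f ⟨(⟨p, hp⟩, k), by simp [hS]⟩ else 0
  have hw : Measurable w := by
    refine measurable_pi_lambda _ fun p => ?_
    by_cases hp : IsChannel G p.1 p.2
    · simpa only [w, hp, dif_pos] using measurable_pi_apply _
    · simp only [w, hp, dif_neg, not_false_eq_true]
      exact measurable_const
  have hwfac : (fun ω => maskedNoise G (fun a b => Δ k a b ω))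
      = w ∘ fun ω (p : S) => noiseFamily G Δ p ω := by
    ext ω p
    by_cases hp : IsChannel G p.1 p.2
    · simp [w, hp, maskedNoise, adjacency_of_isChannel hp, noiseFamily]
    · simp [w, hp, maskedNoise, adjacency_of_not_isChannel hp]
  rw [hwfac]
  simp only [hfac]
  exact h.comp hg hw

end IsChannelNoise

end Noise

/-! ### One step of the tracking energy. -/

/-- The total energy of the tracking errors `x_i - x_l` in the quadratic form `P`. -/
def trackingEnergy (P : Matrix (Fin n) (Fin n) ℝ) (l : Fin N) (x : Fin N → Fin n → ℝ) : ℝ :=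
  ∑ i, (x i - x l) ⬝ᵥ (P *ᵥ (x i - x l))

/-- The Laplacian part is separated from the noise part. The formula covers the leader too, whose
adjacency row is zero. -/
theorem controlInput_eq {G : Digraph (Fin N)} {l : Fin N} (hG : IsLeaderFollower G l) (α : ℝ)
    (K : Fin n → ℝ) (D : Fin N → Fin N → ℝ) (x : Fin N → Fin n → ℝ) (i : Fin N) :
    controlInput G l α K D x i
      = α * ((∑ j, adjacency G i j * (K ⬝ᵥ (x i - x l) - K ⬝ᵥ (x j - x l)))
        + ∑ j, maskedNoise G D (i, j) * (K ⬝ᵥ (x i - x l) - K ⬝ᵥ (x j - x l))) := by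
  have hK : ∀ j, K ⬝ᵥ (x i - x l) - K ⬝ᵥ (x j - x l) = K ⬝ᵥ (x i - x j) := fun j => by
    rw [← dotProduct_sub, sub_sub_sub_cancel_right]
  simp only [hK, maskedNoise, ← Finset.sum_add_distrib]
  rcases eq_or_ne i l with rfl | hi
  · simp [controlInput, hG.adjacency_leader]
  · rw [controlInput, if_neg hi]
    congr 1
    exact Finset.sum_congr rfl fun j _ => by ring

theorem controlInput_leader (G : Digraph (Fin N)) (l : Fin N) (α : ℝ) (K : Fin n → ℝ)
    (D : Fin N → Fin N → ℝ) (x : Fin N → Fin n → ℝ) : controlInput G l α K D x l = 0 := by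
  simp [controlInput]

theorem riccatiGain_dotProduct (A : Matrix (Fin n) (Fin n) ℝ) (B : Fin n → ℝ)
    (P : Matrix (Fin n) (Fin n) ℝ) (e : Fin n → ℝ) :
    riccatiGain A B P ⬝ᵥ e = -((B ⬝ᵥ (P *ᵥ B))⁻¹ * (B ⬝ᵥ (P *ᵥ (A *ᵥ e)))) := by
  rw [riccatiGain, neg_dotProduct, smul_dotProduct, ← dotProduct_mulVec, ← mulVec_mulVec,
    smul_eq_mul]

theorem mul_riccatiGain_dotProduct {A : Matrix (Fin n) (Fin n) ℝ} {B : Fin n → ℝ}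
    {P : Matrix (Fin n) (Fin n) ℝ} (hP : P.PosDef) (e : Fin n → ℝ) :
    (B ⬝ᵥ (P *ᵥ B)) * (riccatiGain A B P ⬝ᵥ e) = -(B ⬝ᵥ (P *ᵥ (A *ᵥ e))) := by
  rw [riccatiGain_dotProduct]
  rcases eq_or_ne B 0 with rfl | hB
  · simp
  · have hb : B ⬝ᵥ (P *ᵥ B) ≠ 0 := by
      simpa using (hP.dotProduct_mulVec_pos hB).ne'
    rw [mul_neg, mul_inv_cancel_left₀ hb]

/-- Expresses the nonlinear Riccati term through `(K e)²`, the quantity controlled by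
`feedback_energy_le`. It includes `B = 0`, where that term vanishes. -/
theorem IsMARESolution.form_eq {A : Matrix (Fin n) (Fin n) ℝ} {B : Fin n → ℝ} {δ : ℝ}
    {P Q : Matrix (Fin n) (Fin n) ℝ} (h : IsMARESolution A B δ Q P) (hP : P.PosDef)
    (e : Fin n → ℝ) :
    (A *ᵥ e) ⬝ᵥ (P *ᵥ (A *ᵥ e))
        - (1 - δ ^ 2) * ((B ⬝ᵥ (P *ᵥ B)) * (riccatiGain A B P ⬝ᵥ e) ^ 2)
      = e ⬝ᵥ (P *ᵥ e) - e ⬝ᵥ (Q *ᵥ e) := by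
  have hPt : Pᵀ = P := by
    rw [← conjTranspose_eq_transpose_of_trivial, hP.isHermitian.eq]
  have hv : (Aᵀ * P) *ᵥ B = B ᵥ* (P * A) := by
    rw [← mulVec_transpose, transpose_mul, hPt]
  have h1 : e ⬝ᵥ ((Aᵀ * P * A) *ᵥ e) = (A *ᵥ e) ⬝ᵥ (P *ᵥ (A *ᵥ e)) := by
    rw [← mulVec_mulVec, ← mulVec_mulVec, dotProduct_mulVec, vecMul_transpose]
  have h2 : (B ᵥ* (P * A)) ⬝ᵥ e = B ⬝ᵥ (P *ᵥ (A *ᵥ e)) := by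
    rw [← dotProduct_mulVec, ← mulVec_mulVec]
  have h3 := congrArg (fun M => e ⬝ᵥ (M *ᵥ e)) h
  simp only [add_mulVec, sub_mulVec, smul_mulVec, vecMulVec_mulVec_eq_smul, dotProduct_add,
    dotProduct_sub, dotProduct_smul, smul_eq_mul, h1, hv, dotProduct_comm e (B ᵥ* (P * A)),
    h2] at h3
  rw [sq (_ ⬝ᵥ _), ← mul_assoc (B ⬝ᵥ (P *ᵥ B)), mul_riccatiGain_dotProduct hP,
    riccatiGain_dotProduct]
  linear_combination -h3

theorem form_add_smul {P : Matrix (Fin n) (Fin n) ℝ} (hP : P.IsHermitian) (z B : Fin n → ℝ)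
    (u : ℝ) :
    (z + u • B) ⬝ᵥ (P *ᵥ (z + u • B))
      = z ⬝ᵥ (P *ᵥ z) + 2 * u * (B ⬝ᵥ (P *ᵥ z)) + (B ⬝ᵥ (P *ᵥ B)) * u ^ 2 := by
  simp only [mulVec_add, mulVec_smul, dotProduct_add, add_dotProduct, dotProduct_smul,
    smul_dotProduct, smul_eq_mul, dotProduct_mulVec_comm_of_isSymm hP z B]
  ring

section Integrability

variable {Ω : Type*} [MeasurableSpace Ω] {μ : Measure Ω}

theorem memLp_dotProduct {y : Ω → Fin n → ℝ} (hy : ∀ a, MemLp (fun ω => y ω a) 2 μ)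
    (v : Fin n → ℝ) : MemLp (fun ω => v ⬝ᵥ y ω) 2 μ := by
  simp only [dotProduct]
  exact memLp_finsetSum _ fun a _ => (hy a).const_mul (v a)

theorem integrable_form {y : Ω → Fin n → ℝ} (hy : ∀ a, MemLp (fun ω => y ω a) 2 μ)
    (P : Matrix (Fin n) (Fin n) ℝ) : Integrable (fun ω => y ω ⬝ᵥ (P *ᵥ y ω)) μ := by
  simp only [dotProduct]
  exact integrable_finsetSum _ fun a _ =>
    integrable_mul_of_memLp_two (hy a) (memLp_dotProduct hy (P a))

theorem integrable_trackingEnergy {X : Ω → Fin N → Fin n → ℝ}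
    (hX : ∀ i a, MemLp (fun ω => X ω i a) 2 μ) (P : Matrix (Fin n) (Fin n) ℝ) (l : Fin N) :
    Integrable (fun ω => trackingEnergy P l (X ω)) μ :=
  integrable_finsetSum _ fun i _ => integrable_form (fun a => (hX i a).sub (hX l a)) P

end Integrability

section Step

variable {Ω : Type*} [MeasurableSpace Ω] {μ : Measure Ω}
  {G : Digraph (Fin N)} {l : Fin N} {σ : Fin N → Fin N → ℝ} {Δ : ℕ → Fin N → Fin N → Ω → ℝ}
  {A : Matrix (Fin n) (Fin n) ℝ} {B : Fin n → ℝ} {α : ℝ} {K : Fin n → ℝ}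
  {X : Ω → Fin N → Fin n → ℝ}

theorem measurable_dotProduct_sub (K : Fin n → ℝ) (i j : Fin N) :
    Measurable fun x : Fin N → Fin n → ℝ => K ⬝ᵥ (x i - x j) := by
  simp only [dotProduct, Pi.sub_apply]
  fun_prop

theorem memLp_noise_term (hΔ : IsChannelNoise G σ μ Δ) (k : ℕ)
    (hXL : ∀ i a, MemLp (fun ω => X ω i a) 2 μ)
    (hXW : IndepFun X (fun ω => maskedNoise G (fun a b => Δ k a b ω)) μ) (i : Fin N) :
    MemLp (fun ω => ∑ j, maskedNoise G (fun a b => Δ k a b ω) (i, j)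
      * (K ⬝ᵥ (X ω i - X ω l) - K ⬝ᵥ (X ω j - X ω l))) 2 μ := by
  refine memLp_finsetSum _ fun j _ => ?_
  exact memLp_two_mul_of_indepFun hXW
    (d := fun x => K ⬝ᵥ (x i - x l) - K ⬝ᵥ (x j - x l))
    ((measurable_dotProduct_sub K i l).sub (measurable_dotProduct_sub K j l))
    ((memLp_dotProduct (fun a => (hXL i a).sub (hXL l a)) K).sub
      (memLp_dotProduct (fun a => (hXL j a).sub (hXL l a)) K))
    (hΔ.memLp_maskedNoise k (i, j))

theorem memLp_step (hG : IsLeaderFollower G l) (hΔ : IsChannelNoise G σ μ Δ) (k : ℕ)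
    (hXL : ∀ i a, MemLp (fun ω => X ω i a) 2 μ)
    (hXW : IndepFun X (fun ω => maskedNoise G (fun a b => Δ k a b ω)) μ) (i : Fin N)
    (a : Fin n) :
    MemLp (fun ω => (A *ᵥ X ω i
      + controlInput G l α K (fun a b => Δ k a b ω) (X ω) i • B) a) 2 μ := by
  have hxi : ∀ i, MemLp (fun ω => K ⬝ᵥ (X ω i - X ω l)) 2 μ := fun i =>
    memLp_dotProduct (fun a => (hXL i a).sub (hXL l a)) K
  simp only [Pi.add_apply, Pi.smul_apply, smul_eq_mul, controlInput_eq hG]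
  refine (memLp_dotProduct (hXL i) (A a)).add (MemLp.mul_const (MemLp.const_mul ?_ α) (B a))
  exact (memLp_finsetSum _ fun j _ => ((hxi i).sub (hxi j)).const_mul _).add
    (memLp_noise_term hΔ k hXL hXW i)

/-- The mean tracking energy of the next state of agent `i`. -/
theorem integral_step_form (hG : IsLeaderFollower G l) (hΔ : IsChannelNoise G σ μ Δ) (k : ℕ)
    {P : Matrix (Fin n) (Fin n) ℝ} (hP : P.PosDef)
    (hK : K = riccatiGain A B P)
    (hX : AEMeasurable X μ) (hXL : ∀ i a, MemLp (fun ω => X ω i a) 2 μ)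
    (hXW : IndepFun X (fun ω => maskedNoise G (fun a b => Δ k a b ω)) μ) (i : Fin N) :
    Integrable (fun ω => (A *ᵥ (X ω i - X ω l) + controlInput G l α K (fun a b => Δ k a b ω) (X ω) i • B) ⬝ᵥ
        (P *ᵥ (A *ᵥ (X ω i - X ω l)
          + controlInput G l α K (fun a b => Δ k a b ω) (X ω) i • B))) μ ∧
    Integrable (fun ω => ((A *ᵥ (X ω i - X ω l)) ⬝ᵥ (P *ᵥ (A *ᵥ (X ω i - X ω l)))
        + (B ⬝ᵥ (P *ᵥ B)) *
          (α ^ 2 * (∑ j, adjacency G i j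
              * (K ⬝ᵥ (X ω i - X ω l) - K ⬝ᵥ (X ω j - X ω l))) ^ 2
            - 2 * α * ((K ⬝ᵥ (X ω i - X ω l)) * ∑ j, adjacency G i j
              * (K ⬝ᵥ (X ω i - X ω l) - K ⬝ᵥ (X ω j - X ω l)))
            + α ^ 2 * ∑ j, adjacency G i j * (σ i j ^ 2
              * (K ⬝ᵥ (X ω i - X ω l) - K ⬝ᵥ (X ω j - X ω l)) ^ 2)))) μ ∧
    ∫ ω, (A *ᵥ (X ω i - X ω l) + controlInput G l α K (fun a b => Δ k a b ω) (X ω) i • B) ⬝ᵥ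
        (P *ᵥ (A *ᵥ (X ω i - X ω l)
          + controlInput G l α K (fun a b => Δ k a b ω) (X ω) i • B)) ∂μ
      = ∫ ω, ((A *ᵥ (X ω i - X ω l)) ⬝ᵥ (P *ᵥ (A *ᵥ (X ω i - X ω l)))
        + (B ⬝ᵥ (P *ᵥ B)) *
          (α ^ 2 * (∑ j, adjacency G i j
              * (K ⬝ᵥ (X ω i - X ω l) - K ⬝ᵥ (X ω j - X ω l))) ^ 2
            - 2 * α * ((K ⬝ᵥ (X ω i - X ω l)) * ∑ j, adjacency G i j
              * (K ⬝ᵥ (X ω i - X ω l) - K ⬝ᵥ (X ω j - X ω l)))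
            + α ^ 2 * ∑ j, adjacency G i j * (σ i j ^ 2
              * (K ⬝ᵥ (X ω i - X ω l) - K ⬝ᵥ (X ω j - X ω l)) ^ 2))) ∂μ := by
  set b := B ⬝ᵥ (P *ᵥ B) with hb
  set xi : Fin N → (Fin N → Fin n → ℝ) → ℝ := fun i x => K ⬝ᵥ (x i - x l) with hxi
  set eta : (Fin N → Fin n → ℝ) → ℝ := fun x => ∑ j, adjacency G i j * (xi i x - xi j x)
    with heta
  set W : Ω → Fin N → ℝ := fun ω j => maskedNoise G (fun a b => Δ k a b ω) (i, j) with hW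
  set q : (Fin N → Fin n → ℝ) → ℝ :=
    fun x => (A *ᵥ (x i - x l)) ⬝ᵥ (P *ᵥ (A *ᵥ (x i - x l))) with hq
  have hxim : ∀ i, Measurable (xi i) := fun i => measurable_dotProduct_sub K i l
  have hetam : Measurable eta :=
    Finset.measurable_sum _ fun j _ => ((hxim i).sub (hxim j)).const_mul _
  have hxiL : ∀ i, MemLp (fun ω => xi i (X ω)) 2 μ := fun i =>
    memLp_dotProduct (fun a => (hXL i a).sub (hXL l a)) K
  have hetaL : MemLp (fun ω => eta (X ω)) 2 μ :=
    memLp_finsetSum _ fun j _ => ((hxiL i).sub (hxiL j)).const_mul _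
  have hdm : ∀ j, Measurable fun x => xi i x - xi j x := fun j => (hxim i).sub (hxim j)
  have hdL : ∀ j, MemLp (fun ω => xi i (X ω) - xi j (X ω)) 2 μ := fun j =>
    (hxiL i).sub (hxiL j)
  have hqI : Integrable (fun ω => q (X ω)) μ :=
    integrable_form (fun a => memLp_dotProduct (fun a => (hXL i a).sub (hXL l a)) (A a)) P
  have hWm : AEMeasurable W μ :=
    aemeasurable_pi_lambda _ fun j =>
      (hΔ.memLp_maskedNoise k (i, j)).aestronglyMeasurable.aemeasurable
  have hrow : Measurable fun (w : Fin N × Fin N → ℝ) j => w (i, j) := by fun_prop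
  have hXWi : IndepFun X W μ := hXW.comp measurable_id hrow
  have hWL : ∀ j, MemLp (fun ω => W ω j) 2 μ := fun j => hΔ.memLp_maskedNoise k (i, j)
  have hzL : MemLp (fun ω => ∑ j, W ω j * (xi i (X ω) - xi j (X ω))) 2 μ :=
    memLp_noise_term hΔ k hXL hXW i
  -- The function `g` is the coefficient of the noise term `zeta` in the expansion `hleft`.
  have hcross := integral_noise_mul_eq_zero hX hWm hXWi hdm hdL hWL
    (fun j => hΔ.integral_maskedNoise k (i, j))
    (g := fun x => 2 * b * α ^ 2 * eta x - 2 * b * α * xi i x)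
    ((hetam.const_mul _).sub ((hxim i).const_mul _))
    ((hetaL.const_mul _).sub ((hxiL i).const_mul _))
  have hsq := integral_noise_sq hX hWm hXWi hdm hdL hWL
    (fun j j' hj => hΔ.integral_maskedNoise_mul k (by simpa using hj))
    (fun j => hΔ.integral_maskedNoise_sq k (i, j))
  set zeta : Ω → ℝ := fun ω => ∑ j, W ω j * (xi i (X ω) - xi j (X ω)) with hzeta
  have hI1 : Integrable (fun ω => q (X ω) + b * (α ^ 2 * eta (X ω) ^ 2
      - 2 * α * (xi i (X ω) * eta (X ω)))) μ :=
    hqI.add (((hetaL.integrable_sq.const_mul _).sub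
      ((integrable_mul_of_memLp_two (hxiL i) hetaL).const_mul _)).const_mul _)
  have hI2 : Integrable (fun ω => zeta ω
      * (2 * b * α ^ 2 * eta (X ω) - 2 * b * α * xi i (X ω))) μ :=
    integrable_mul_of_memLp_two hzL ((hetaL.const_mul _).sub ((hxiL i).const_mul _))
  have hI3 : Integrable (fun ω => b * α ^ 2 * zeta ω ^ 2) μ := hzL.integrable_sq.const_mul _
  have hI4 : ∀ j, Integrable (fun ω => adjacency G i j
      * (σ i j ^ 2 * (xi i (X ω) - xi j (X ω)) ^ 2)) μ := fun j =>
    ((hdL j).integrable_sq.const_mul _).const_mul _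
  -- With `u = α (eta + zeta)` and `Bᵀ P A e = -b ξ`, the increment of the form is `b u² - 2 b u ξ`,
  -- sorted here by powers of `zeta`.
  have hleft : ∀ ω, (A *ᵥ (X ω i - X ω l)
        + controlInput G l α K (fun a b => Δ k a b ω) (X ω) i • B) ⬝ᵥ
        (P *ᵥ (A *ᵥ (X ω i - X ω l)
          + controlInput G l α K (fun a b => Δ k a b ω) (X ω) i • B))
      = (q (X ω) + b * (α ^ 2 * eta (X ω) ^ 2 - 2 * α * (xi i (X ω) * eta (X ω))))
        + zeta ω * (2 * b * α ^ 2 * eta (X ω) - 2 * b * α * xi i (X ω))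
        + b * α ^ 2 * zeta ω ^ 2 := by
    intro ω
    have hu : controlInput G l α K (fun a b => Δ k a b ω) (X ω) i
        = α * (eta (X ω) + zeta ω) := controlInput_eq hG α K _ (X ω) i
    have hg : b * xi i (X ω) = -(B ⬝ᵥ (P *ᵥ (A *ᵥ (X ω i - X ω l)))) := by
      rw [hxi, hK]
      exact mul_riccatiGain_dotProduct hP _
    rw [form_add_smul hP.isHermitian, hu, ← hb]
    linear_combination (2 * α * (eta (X ω) + zeta ω)) * hg
  have hright : ∀ ω, q (X ω) + b * (α ^ 2 * eta (X ω) ^ 2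
        - 2 * α * (xi i (X ω) * eta (X ω))
        + α ^ 2 * ∑ j, adjacency G i j * (σ i j ^ 2 * (xi i (X ω) - xi j (X ω)) ^ 2))
      = (q (X ω) + b * (α ^ 2 * eta (X ω) ^ 2 - 2 * α * (xi i (X ω) * eta (X ω))))
        + b * α ^ 2 * ∑ j, adjacency G i j * (σ i j ^ 2 * (xi i (X ω) - xi j (X ω)) ^ 2) := by
    intro ω
    ring
  have hvar : ∫ ω, zeta ω ^ 2 ∂μ
      = ∫ ω, ∑ j, adjacency G i j * (σ i j ^ 2 * (xi i (X ω) - xi j (X ω)) ^ 2) ∂μ := by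
    rw [hsq, integral_finsetSum _ fun j _ => hI4 j]
    refine Finset.sum_congr rfl fun j _ => ?_
    rw [integral_const_mul, integral_const_mul, mul_assoc]
  have hI12 : Integrable (fun ω =>
      (q (X ω) + b * (α ^ 2 * eta (X ω) ^ 2 - 2 * α * (xi i (X ω) * eta (X ω))))
        + zeta ω * (2 * b * α ^ 2 * eta (X ω) - 2 * b * α * xi i (X ω))) μ := hI1.add hI2
  have hI5 : Integrable (fun ω => b * α ^ 2
      * ∑ j, adjacency G i j * (σ i j ^ 2 * (xi i (X ω) - xi j (X ω)) ^ 2)) μ :=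
    (integrable_finsetSum _ fun j _ => hI4 j).const_mul _
  refine ⟨(hI12.add hI3).congr (ae_of_all _ fun ω => (hleft ω).symm),
    (hI1.add hI5).congr (ae_of_all _ fun ω => (hright ω).symm), ?_⟩
  refine (integral_congr_ae (ae_of_all _ hleft)).trans
    (Eq.trans ?_ (integral_congr_ae (ae_of_all _ hright)).symm)
  rw [integral_add hI12 hI3, integral_add hI1 hI2, hcross, add_zero,
    integral_add hI1 hI5, integral_const_mul, integral_const_mul, hvar]

end Step

/-! ### Geometric decay and consensus. -/

section Consensus

variable {Ω : Type*} [MeasurableSpace Ω] {μ : Measure Ω}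
  {G : Digraph (Fin N)} {l : Fin N} {σ : Fin N → Fin N → ℝ} {Δ : ℕ → Fin N → Fin N → Ω → ℝ}
  {A P Q : Matrix (Fin n) (Fin n) ℝ} {B : Fin n → ℝ} {α δ lam2 lamN s c : ℝ}
  {X : Ω → Fin N → Fin n → ℝ}

/-- The feedback terms sum to at most `-(1 - δ²) b ∑ ξᵢ²`; the Riccati equation converts this into a
loss of `eᵢᵀ Q eᵢ` per agent, at least the fraction `c` of its energy. -/
theorem integral_trackingEnergy_step_le (hG : IsLeaderFollower G l)
    (hΔ : IsChannelNoise G σ μ Δ) (k : ℕ)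
    (hlam2 : IsLeast (nonzeroEigenvalues G) lam2)
    (hlamN : IsGreatest (nonzeroEigenvalues G) lamN)
    (hs : ∀ v ∈ channelVariances G l σ, v ≤ s)
    (h2 : (α * lam2 - 1) ^ 2 + α ^ 2 * s * lam2 ≤ δ ^ 2)
    (hN : (α * lamN - 1) ^ 2 + α ^ 2 * s * lamN ≤ δ ^ 2)
    (hP : P.PosDef) (hmare : IsMARESolution A B δ Q P)
    (hc : ∀ x, c * (x ⬝ᵥ (P *ᵥ x)) ≤ x ⬝ᵥ (Q *ᵥ x))
    (hX : AEMeasurable X μ) (hXL : ∀ i a, MemLp (fun ω => X ω i a) 2 μ)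
    (hXW : IndepFun X (fun ω => maskedNoise G (fun a b => Δ k a b ω)) μ) :
    ∫ ω, trackingEnergy P l (fun i => A *ᵥ X ω i
        + controlInput G l α (riccatiGain A B P) (fun a b => Δ k a b ω) (X ω) i • B) ∂μ
      ≤ (1 - c) * ∫ ω, trackingEnergy P l (X ω) ∂μ := by
  set K := riccatiGain A B P with hK
  have hstep := integral_step_form (α := α) hG hΔ k hP hK hX hXL hXW
  have hdiff : ∀ ω i, (A *ᵥ X ω i + controlInput G l α K (fun a b => Δ k a b ω) (X ω) i • B)
      - (A *ᵥ X ω l + controlInput G l α K (fun a b => Δ k a b ω) (X ω) l • B)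
      = A *ᵥ (X ω i - X ω l)
        + controlInput G l α K (fun a b => Δ k a b ω) (X ω) i • B := by
    intro ω i
    rw [controlInput_leader, zero_smul, add_zero, mulVec_sub]
    abel
  have hb0 : 0 ≤ B ⬝ᵥ (P *ᵥ B) := by simpa using hP.posSemidef.dotProduct_mulVec_nonneg B
  simp only [trackingEnergy, hdiff]
  rw [integral_finsetSum _ fun i _ => (hstep i).1,
    Finset.sum_congr rfl fun i _ => (hstep i).2.2,
    ← integral_finsetSum _ fun i _ => (hstep i).2.1, ← integral_const_mul]
  refine integral_mono (integrable_finsetSum _ fun i _ => (hstep i).2.1)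
    ((integrable_trackingEnergy hXL P l).const_mul _) fun ω => ?_
  have hf := hG.feedback_energy_le hlam2 hlamN hs h2 hN
    (x := fun i => K ⬝ᵥ (X ω i - X ω l)) (by simp)
  have hf' := mul_le_mul_of_nonneg_left hf hb0
  simp only [Finset.sum_add_distrib, ← Finset.mul_sum] at hf' ⊢
  have hsum : ∑ i, (A *ᵥ (X ω i - X ω l)) ⬝ᵥ (P *ᵥ (A *ᵥ (X ω i - X ω l)))
      - (1 - δ ^ 2) * ((B ⬝ᵥ (P *ᵥ B)) * ∑ i, (K ⬝ᵥ (X ω i - X ω l)) ^ 2)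
      ≤ (1 - c) * ∑ i, (X ω i - X ω l) ⬝ᵥ (P *ᵥ (X ω i - X ω l)) := by
    rw [Finset.mul_sum, Finset.mul_sum, Finset.mul_sum, ← Finset.sum_sub_distrib]
    refine Finset.sum_le_sum fun i _ => ?_
    rw [hK, hmare.form_eq hP]
    have := hc (X ω i - X ω l)
    linarith
  linarith

theorem mul_norm_sq_sub_le_trackingEnergy (hP : P.PosDef)
    (hc0 : 0 ≤ c) (hc : ∀ x, c * (x ⬝ᵥ x) ≤ x ⬝ᵥ (P *ᵥ x)) (x : Fin N → Fin n → ℝ)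
    (i j : Fin N) :
    c * ‖WithLp.toLp 2 (x i - x j)‖ ^ 2 ≤ 4 * trackingEnergy P l x := by
  have hnorm : ∀ y : Fin n → ℝ, ‖WithLp.toLp 2 y‖ ^ 2 = y ⬝ᵥ y := fun y => by
    rw [EuclideanSpace.norm_sq_eq]
    exact Finset.sum_congr rfl fun a _ => by
      rw [Real.norm_eq_abs, sq_abs, sq]
  have hle : ∀ i, (x i - x l) ⬝ᵥ (P *ᵥ (x i - x l)) ≤ trackingEnergy P l x := fun i =>
    Finset.single_le_sum (f := fun i => (x i - x l) ⬝ᵥ (P *ᵥ (x i - x l)))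
      (fun i _ => by simpa using hP.posSemidef.dotProduct_mulVec_nonneg (x i - x l))
      (Finset.mem_univ i)
  have htri : ‖WithLp.toLp 2 (x i - x j)‖ ^ 2
      ≤ 2 * ‖WithLp.toLp 2 (x i - x l)‖ ^ 2 + 2 * ‖WithLp.toLp 2 (x j - x l)‖ ^ 2 := by
    have h1 : WithLp.toLp 2 (x i - x j)
        = WithLp.toLp 2 (x i - x l) - WithLp.toLp 2 (x j - x l) := by
      rw [← WithLp.toLp_sub, sub_sub_sub_cancel_right]
    have h2 := norm_sub_le (WithLp.toLp 2 (x i - x l)) (WithLp.toLp 2 (x j - x l))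
    rw [← h1] at h2
    have h3 := pow_le_pow_left₀ (norm_nonneg _) h2 2
    nlinarith [sq_nonneg (‖WithLp.toLp 2 (x i - x l)‖ - ‖WithLp.toLp 2 (x j - x l)‖)]
  have h4 := mul_le_mul_of_nonneg_left htri hc0
  have h5 := (hc (x i - x l)).trans (hle i)
  have h6 := (hc (x j - x l)).trans (hle j)
  rw [← hnorm] at h5 h6
  linarith

/-- Mean square consensus under the Riccati gain. -/
theorem meanSquareConsensus_riccatiGain [IsProbabilityMeasure μ] (hG : IsLeaderFollower G l)
    (hΔ : IsChannelNoise G σ μ Δ)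
    (hlam2 : IsLeast (nonzeroEigenvalues G) lam2)
    (hlamN : IsGreatest (nonzeroEigenvalues G) lamN)
    (hs : ∀ v ∈ channelVariances G l σ, v ≤ s)
    (h2 : (α * lam2 - 1) ^ 2 + α ^ 2 * s * lam2 ≤ δ ^ 2)
    (hN : (α * lamN - 1) ^ 2 + α ^ 2 * s * lamN ≤ δ ^ 2)
    (hP : P.PosDef) (hQ : Q.PosDef) (hmare : IsMARESolution A B δ Q P)
    {x0 : Ω → Fin N → Fin n → ℝ} (hx0 : MemLp x0 2 μ)
    (hind : IndepFun x0 (fun ω p => noiseFamily G Δ p ω) μ) :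
    MeanSquareConsensus μ (fun k i ω =>
      trajectory A B G l α (riccatiGain A B P) (fun t a b => Δ t a b ω) (x0 ω) k i) := by
  obtain ⟨c, hc0, hc1, hc⟩ := exists_mul_form_le hP hQ
  -- Comparison with the identity returns from the `P`-energy to the Euclidean norm.
  obtain ⟨c', hc'0, -, hc'⟩ := exists_mul_form_le PosDef.one hP
  simp only [one_mulVec] at hc'
  set K := riccatiGain A B P with hK
  set x : ℕ → Ω → Fin N → Fin n → ℝ := fun k ω =>
    trajectory A B G l α K (fun t a b => Δ t a b ω) (x0 ω) k with hx
  have hx0m : AEMeasurable x0 μ := hx0.aestronglyMeasurable.aemeasurable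
  have hxm : ∀ k, AEMeasurable (x k) μ := fun k => hΔ.aemeasurable_trajectory hx0m k
  have hxW : ∀ k, IndepFun (x k) (fun ω => maskedNoise G (fun a b => Δ k a b ω)) μ := fun k =>
    hΔ.indepFun_trajectory_maskedNoise hx0m hind k
  have hxL : ∀ k i a, MemLp (fun ω => x k ω i a) 2 μ := by
    intro k
    induction k with
    | zero => exact fun i a => (hx0.eval i).eval a
    | succ k ih => exact fun i a => memLp_step hG hΔ k ih (hxW k) i a
  have hdecay : ∀ k, ∫ ω, trackingEnergy P l (x k ω) ∂μ
      ≤ (1 - c) ^ k * ∫ ω, trackingEnergy P l (x 0 ω) ∂μ := by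
    intro k
    induction k with
    | zero => simp
    | succ k ih =>
      refine (integral_trackingEnergy_step_le (α := α) hG hΔ k hlam2 hlamN hs h2 hN hP hmare hc
        (hxm k) (hxL k) (hxW k)).trans ?_
      rw [pow_succ', mul_assoc]
      exact mul_le_mul_of_nonneg_left ih (by linarith)
  intro i j
  have hint : ∀ k, Integrable (fun ω => ‖WithLp.toLp 2 (x k ω i - x k ω j)‖ ^ 2) μ := by
    intro k
    simp only [EuclideanSpace.norm_sq_eq, Real.norm_eq_abs, sq_abs]
    exact integrable_finsetSum _ fun a _ => ((hxL k i a).sub (hxL k j a)).integrable_sq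
  refine ⟨hint, ?_⟩
  have hlim : Tendsto (fun k : ℕ => (1 - c) ^ k
      * (4 / c' * ∫ ω, trackingEnergy P l (x 0 ω) ∂μ)) atTop (𝓝 0) := by
    simpa using (tendsto_pow_atTop_nhds_zero_of_lt_one (by linarith : 0 ≤ 1 - c)
      (by linarith)).mul_const (4 / c' * ∫ ω, trackingEnergy P l (x 0 ω) ∂μ)
  refine squeeze_zero (fun k => integral_nonneg fun ω => by positivity) (fun k => ?_) hlim
  have h1 : ∫ ω, ‖WithLp.toLp 2 (x k ω i - x k ω j)‖ ^ 2 ∂μ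
      ≤ ∫ ω, 4 / c' * trackingEnergy P l (x k ω) ∂μ := by
    refine integral_mono (hint k) ((integrable_trackingEnergy (hxL k) P l).const_mul _)
      fun ω => ?_
    have := mul_norm_sq_sub_le_trackingEnergy (l := l) hP hc'0.le hc' (x k ω) i j
    rw [div_mul_eq_mul_div, le_div_iff₀ hc'0]
    linarith
  refine h1.trans ?_
  rw [integral_const_mul, mul_left_comm]
  exact mul_le_mul_of_nonneg_left (hdecay k) (by positivity)

end Consensus

end LeaderFollower

end

/-! ### Choice of `δ` and conclusion. -/

open LeaderFollower in
theorem theorem2 {N n : ℕ}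
    (A : Matrix (Fin n) (Fin n) ℝ) (B : Fin n → ℝ) (hAB : Stabilizable A B)
    (G : Digraph (Fin N)) (l : Fin N) (hG : IsLeaderFollower G l)
    (lam2 lamN : ℝ) (hlam2 : IsLeast (nonzeroEigenvalues G) lam2)
    (hlamN : IsGreatest (nonzeroEigenvalues G) lamN)
    (σ : Fin N → Fin N → ℝ) (s : ℝ) (hs : IsGreatest (channelVariances G l σ) s)
    (α : ℝ) (hα : 0 < α)
    (hcond2 : (α * lam2 - 1) ^ 2 + α ^ 2 * s * lam2 < 1 / mahler A ^ 2)
    (hcondN : (α * lamN - 1) ^ 2 + α ^ 2 * s * lamN < 1 / mahler A ^ 2) :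
    ∃ K : Fin n → ℝ,
      (∃ (δ : ℝ) (Q P : Matrix (Fin n) (Fin n) ℝ),
        (α * lam2 - 1) ^ 2 + α ^ 2 * s * lam2 ≤ δ ^ 2 ∧
        (α * lamN - 1) ^ 2 + α ^ 2 * s * lamN ≤ δ ^ 2 ∧
        δ ^ 2 < 1 / mahler A ^ 2 ∧
        Q.PosDef ∧ P.PosDef ∧ IsMARESolution A B δ Q P ∧ K = riccatiGain A B P) ∧
      ∀ (Ω : Type*) [MeasurableSpace Ω] (μ : Measure Ω) [IsProbabilityMeasure μ]
        (Δ : ℕ → Fin N → Fin N → Ω → ℝ) (x0 : Ω → Fin N → Fin n → ℝ),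
        IsChannelNoise G σ μ Δ →
        MemLp x0 2 μ →
        IndepFun x0 (fun ω p => noiseFamily G Δ p ω) μ →
        MeanSquareConsensus μ (fun k i ω =>
          trajectory A B G l α K (fun t a b => Δ t a b ω) (x0 ω) k i) := by
  have hM : 0 < 1 / mahler A ^ 2 := by
    have : 1 ≤ mahler A := one_le_prod_map_max _
    positivity
  -- The maximum with zero makes `d = δ²` strictly positive, as needed for `gam = 1 / δ²`, even if
  -- both quadratic values vanish.
  obtain ⟨d, hd, hdM⟩ := exists_between (max_lt (max_lt hcond2 hcondN) hM)
  obtain ⟨hd2, hdN⟩ := max_le_iff.1 ((le_max_left _ _).trans hd.le)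
  have hd0 : 0 < d := (le_max_right _ _).trans_lt hd
  have hsq : √d ^ 2 = d := Real.sq_sqrt hd0.le
  obtain ⟨Q, P, hQ, hP, hmare⟩ := exists_isMARESolution hAB (δ := √d) (by rwa [hsq]) (by rwa [hsq])
  rw [← hsq] at hd2 hdN
  refine ⟨riccatiGain A B P, ⟨√d, Q, P, hd2, hdN, by rwa [hsq], hQ, hP, hmare, rfl⟩, ?_⟩
  intro Ω _ μ _ Δ x0 hΔ hx0 hind
  exact meanSquareConsensus_riccatiGain hG hΔ hlam2 hlamN hs.2 hd2 hdN hP hQ hmare hx0 hind
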